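/- Let $p$ be a prime and let $m_1>m_2\ge 1$ be integers, with $m_2>1$ if $p=2$. For odd $p$ fix a square non-residue $\eta\in\mathbb F_p^*$. Consider the finite $p$-groups $G$ with minimal number of generators $d(G)=3$, $\Phi(G)\le Z(G)$ and $G'\cong C_p^3$, such that $G/G'$ has type $(p^{m_1},p^{m_2},p^{m_3})$ with $m_3=m_2$, that is, $G/G'\cong C_{p^{m_1}}\times C_{p^{m_2}}\times C_{p^{m_3}}$. If $a_1,a_2,a_3\in G$ satisfy $G/G'=\langle a_1G'\rangle\times\langle a_2G'\rangle\times\langle a_3G'\rangle$ with $o(a_iG')=p^{m_i}$, put $x=[a_2,a_3]$, $y=[a_3,a_1]$, $z=[a_1,a_2]$; a $3\times3$ matrix $(w_{ij})$ over $\mathbb F_p$ with $a_i^{p^{m_i}}=x^{w_{i1}}y^{w_{i2}}z^{w_{i3}}$ for $i=1,2,3$ is called a characteristic matrix of $G$. **Theorem 4.1.** Every such group $G$ has a characteristic matrix in the list below. Every matrix in the list is a characteristic matrix of such a group, which it determines up to isomorphism (for the given $p,m_1,m_2$). Different matrices in the list give non-isomorphic groups. Here rows are separated by semicolons, $\nu\in\{1,\eta\}$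 for odd $p$ and $\nu=1$ for $p=2$, $t\in\mathbb F_p$ with $t\ne0$, and $r=1,2,\dots,p-2$. (1) For odd $p$: (D1) $(1,0,0;\,0,0,1;\,0,-1,0)$, (D2) $(1,0,0;\,0,\nu,1;\,0,-1,0)$, (D3) $(1,0,0;\,0,1,0;\,0,0,\nu)$, (D4) $(1,0,0;\,0,1,1;\,0,-1,r)$, (E1) $(0,0,0;\,0,0,1;\,0,-1,0)$, (E2) $(0,0,0;\,0,1,1;\,0,-1,0)$, (E3) $(0,0,0;\,0,1,0;\,0,0,\nu)$, (E4) $(0,0,0;\,0,1,1;\,0,-1,r)$. (2) For $p=2$: (D5) $(1,0,0;\,0,0,1;\,0,1,0)$, (D6) $(1,0,0;\,0,1,0;\,0,0,1)$, (D7) $(1,0,0;\,0,1,0;\,0,1,1)$, (E5) $(0,0,0;\,0,0,1;\,0,1,0)$, (E6) $(0,0,0;\,0,1,0;\,0,0,1)$, (E7) $(0,0,0;\,0,1,0;\,0,1,1)$. (3) For both odd $p$ and $p=2$: (D8) $(0,0,1;\,0,1,0;\,t,0,0)$, (D9) $(0,0,1;\,1,0,0;\,0,1,0)$, (E8) $(1,0,0;\,0,0,1;\,0,0,0)$,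 (E9) $(1,0,0;\,0,0,0;\,0,0,\nu)$, (E10) $(0,0,0;\,0,0,1;\,1,0,0)$, (E11) $(0,0,0;\,1,0,0;\,0,0,1)$, (E12) $(0,0,1;\,0,1,0;\,0,0,0)$, (E13) $(0,0,1;\,0,0,0;\,0,1,0)$, (E14) $(0,0,1;\,1,0,0;\,0,0,0)$, (E15) $(0,0,1;\,0,0,0;\,t,0,0)$, (F1) $(1,0,0;\,0,0,0;\,0,0,0)$, (F2) $(0,0,0;\,0,0,1;\,0,0,0)$, (F3) $(0,0,0;\,0,0,0;\,0,0,1)$, (F4) $(0,0,0;\,1,0,0;\,0,0,0)$, (F5) $(0,0,0;\,0,0,0;\,0,0,0)$, (F6) $(0,0,1;\,0,0,0;\,0,0,0)$. -/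

import Mathlib

open scoped commutatorElement

namespace CharMat

/-- The finite `p`-groups `G` with `d(G) = 3`, `Φ(G) ≤ Z(G)`, `G' ≅ C_p ^ 3`, such that `G / G'`
has type `(p ^ m 0, p ^ m 1, p ^ m 2)`. -/
structure InClass (p : ℕ) (m : Fin 3 → ℕ) (G : Type*) [Group G] [Finite G] : Prop where
  isPGroup : IsPGroup p G
  rank_eq : Group.rank G = 3
  frattini_le : frattini G ≤ Subgroup.center G
  derived : Nonempty (commutator G ≃* Multiplicative (Fin 3 → ZMod p))
  type_eq : Nonempty ((G ⧸ commutator G) ≃* Multiplicative ((i : Fin 3) → ZMod (p ^ m i)))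

/-- `G / G'` is the internal direct product of the cyclic subgroups generated by the images of
`a 0`, `a 1`, `a 2`, and these images have orders `p ^ m 0`, `p ^ m 1`, `p ^ m 2`. -/
structure IsCharGenerators (p : ℕ) (m : Fin 3 → ℕ) {G : Type*} [Group G] (a : Fin 3 → G) :
    Prop where
  order_eq : ∀ i, orderOf (Abelianization.of (a i)) = p ^ m i
  indep : iSupIndep fun i => Subgroup.zpowers (Abelianization.of (a i))
  iSup_eq : ⨆ i, Subgroup.zpowers (Abelianization.of (a i)) = ⊤

/-- `w` is a characteristic matrix of `G`: for some generators `a` as in `IsCharGenerators`,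
`a i ^ (p ^ m i) = x ^ w i 0 * y ^ w i 1 * z ^ w i 2`, where `x = [a 1, a 2]`, `y = [a 2, a 0]`
and `z = [a 0, a 1]`. (The exponents are residues modulo `p`; `ZMod.val` picks representatives, and
the choice does not matter when `G'` has exponent `p`.) -/
def IsCharMatrix (p : ℕ) (m : Fin 3 → ℕ) (G : Type*) [Group G]
    (w : Matrix (Fin 3) (Fin 3) (ZMod p)) : Prop :=
  ∃ a : Fin 3 → G, IsCharGenerators p m a ∧
    ∀ i, a i ^ (p ^ m i) =
      ⁅a 1, a 2⁆ ^ (w i 0).val * ⁅a 2, a 0⁆ ^ (w i 1).val * ⁅a 0, a 1⁆ ^ (w i 2).val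

/-- The list of matrices over the field of `p` elements; `η` is the fixed square non-residue, which
is only used for odd `p`. -/
inductive InList (p : ℕ) (η : ZMod p) : Matrix (Fin 3) (Fin 3) (ZMod p) → Prop
  -- odd `p`
  | D1 (hp : p ≠ 2) : InList p η !![1, 0, 0; 0, 0, 1; 0, -1, 0]
  | D2 (hp : p ≠ 2) (ν : ZMod p) (hν : ν = 1 ∨ ν = η) :
      InList p η !![1, 0, 0; 0, ν, 1; 0, -1, 0]
  | D3 (hp : p ≠ 2) (ν : ZMod p) (hν : ν = 1 ∨ ν = η) :
      InList p η !![1, 0, 0; 0, 1, 0; 0, 0, ν]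
  | D4 (hp : p ≠ 2) (r : ℕ) (hr : 1 ≤ r) (hr' : r ≤ p - 2) :
      InList p η !![1, 0, 0; 0, 1, 1; 0, -1, (r : ZMod p)]
  | E1 (hp : p ≠ 2) : InList p η !![0, 0, 0; 0, 0, 1; 0, -1, 0]
  | E2 (hp : p ≠ 2) : InList p η !![0, 0, 0; 0, 1, 1; 0, -1, 0]
  | E3 (hp : p ≠ 2) (ν : ZMod p) (hν : ν = 1 ∨ ν = η) :
      InList p η !![0, 0, 0; 0, 1, 0; 0, 0, ν]
  | E4 (hp : p ≠ 2) (r : ℕ) (hr : 1 ≤ r) (hr' : r ≤ p - 2) :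
      InList p η !![0, 0, 0; 0, 1, 1; 0, -1, (r : ZMod p)]
  -- `p = 2`
  | D5 (hp : p = 2) : InList p η !![1, 0, 0; 0, 0, 1; 0, 1, 0]
  | D6 (hp : p = 2) : InList p η !![1, 0, 0; 0, 1, 0; 0, 0, 1]
  | D7 (hp : p = 2) : InList p η !![1, 0, 0; 0, 1, 0; 0, 1, 1]
  | E5 (hp : p = 2) : InList p η !![0, 0, 0; 0, 0, 1; 0, 1, 0]
  | E6 (hp : p = 2) : InList p η !![0, 0, 0; 0, 1, 0; 0, 0, 1]
  | E7 (hp : p = 2) : InList p η !![0, 0, 0; 0, 1, 0; 0, 1, 1]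
  -- all `p`
  | D8 (t : ZMod p) (ht : t ≠ 0) : InList p η !![0, 0, 1; 0, 1, 0; t, 0, 0]
  | D9 : InList p η !![0, 0, 1; 1, 0, 0; 0, 1, 0]
  | E8 : InList p η !![1, 0, 0; 0, 0, 1; 0, 0, 0]
  | E9 (ν : ZMod p) (hν : ν = 1 ∨ (p ≠ 2 ∧ ν = η)) :
      InList p η !![1, 0, 0; 0, 0, 0; 0, 0, ν]
  | E10 : InList p η !![0, 0, 0; 0, 0, 1; 1, 0, 0]
  | E11 : InList p η !![0, 0, 0; 1, 0, 0; 0, 0, 1]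
  | E12 : InList p η !![0, 0, 1; 0, 1, 0; 0, 0, 0]
  | E13 : InList p η !![0, 0, 1; 0, 0, 0; 0, 1, 0]
  | E14 : InList p η !![0, 0, 1; 1, 0, 0; 0, 0, 0]
  | E15 (t : ZMod p) (ht : t ≠ 0) : InList p η !![0, 0, 1; 0, 0, 0; t, 0, 0]
  | F1 : InList p η !![1, 0, 0; 0, 0, 0; 0, 0, 0]
  | F2 : InList p η !![0, 0, 0; 0, 0, 1; 0, 0, 0]
  | F3 : InList p η !![0, 0, 0; 0, 0, 0; 0, 0, 1]
  | F4 : InList p η !![0, 0, 0; 1, 0, 0; 0, 0, 0]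
  | F5 : InList p η !![0, 0, 0; 0, 0, 0; 0, 0, 0]
  | F6 : InList p η !![0, 0, 1; 0, 0, 0; 0, 0, 0]

end CharMat

universe u v

/-! A group of the class is governed by how the powers `a i ^ p ^ m i` sit in `G' ≅ F_p^3`. The free
object `Model p` lives on `ℤ^3 × F_p^3`. The relators attached to a matrix `w` form a central
subgroup that meets the central part `F_p^3` trivially, so for every `w` the quotient lies in the
class and has order `p ^ (∑ i, m i + 3)`. Conversely, suitable generators of a group of the class
give a surjection from the model that kills the relators, and by this count its kernel is nothing
more (`InClass.presents`). So `w` determines the group, and the question becomes when two matrices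
differ by a change of generators.

Let `C` be the matrix of exponents of new generators. Commutators transform by the cofactor matrix
of `C`. Taking `p ^ a`-th powers is linear in the exponents, because `(p ^ a).choose 2` vanishes
modulo `p`. Writing `p ^ m i * C i j = p ^ m j * N i j`, the two facts give `w' * cof C = N * w`,
that is, `det C • w' = N * w * Cᵀ`. As `m₁ > m₂`, modulo `p` the matrix `C` is block upper
triangular and `N` block lower triangular, with the same diagonal blocks and independent
off-diagonal entries. This is the relation `Similar` (`Presents.similar`,
`Similar.exists_presents`).

The rest is linear algebra over `F_p`. Whether the last two entries of the first row vanish is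
invariant. If they do not, that row can be made `(0, 0, 1)` and few parameters survive. If they do,
the lower right block `M` changes by `B * M * Bᵀ = (c * det B) • M'`, where `c = det B` if the
corner is normalised to `1` and `c` is free if it is `0`. For odd `p` the symmetric part of `M` is
diagonalised and the skew part rescaled; for `p = 2` the blocks are enumerated. A zero corner
leaves, in addition, a column modulo the column space of `M`. Distinctness (`InList.eq_of_similar`)
comes from the skew part, the determinant and square classes. -/

namespace CharMat

/-! ### Commutator calculus in class two -/

section ClassTwo

variable {G : Type*} [Group G]

theorem commute_of_mem_commutator (hZ : commutator G ≤ Subgroup.center G) {g : G}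
    (hg : g ∈ commutator G) (h : G) : Commute g h :=
  (Subgroup.mem_center_iff.mp (hZ hg) h).symm

theorem commutatorElement_mem (g h : G) : ⁅g, h⁆ ∈ commutator G :=
  Subgroup.commutator_mem_commutator (Subgroup.mem_top g) (Subgroup.mem_top h)

/-- In a group of nilpotency class at most two, `⁅·, b⁆` is a homomorphism. -/
def commutatorHom (hZ : commutator G ≤ Subgroup.center G) (b : G) : G →* G where
  toFun g := ⁅g, b⁆
  map_one' := commutatorElement_one_left b
  map_mul' g h := by
    have e := (commute_of_mem_commutator hZ (commutatorElement_mem h b) g).eq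
    calc ⁅g * h, b⁆ = g * ⁅h, b⁆ * (b * g⁻¹ * b⁻¹) := by simp only [commutatorElement_def]; group
      _ = ⁅h, b⁆ * ⁅g, b⁆ := by rw [← e]; simp only [commutatorElement_def]; group
      _ = ⁅g, b⁆ * ⁅h, b⁆ := (commute_of_mem_commutator hZ (commutatorElement_mem h b) _).eq

theorem commutatorElement_zpow_left (hZ : commutator G ≤ Subgroup.center G) (a b : G) (i : ℤ) :
    ⁅a ^ i, b⁆ = ⁅a, b⁆ ^ i :=
  map_zpow (commutatorHom hZ b) a i

theorem zpow_mul_zpow_comm (hZ : commutator G ≤ Subgroup.center G) (a b : G) (i j : ℤ) :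
    a ^ i * b ^ j = b ^ j * a ^ i * ⁅a, b⁆ ^ (i * j) := by
  have h : ⁅a ^ i, b ^ j⁆ = ⁅a, b⁆ ^ (i * j) := by
    rw [commutatorElement_zpow_left hZ, ← inv_inj, ← inv_zpow, commutatorElement_inv,
      commutatorElement_zpow_left hZ, ← commutatorElement_inv a b, zpow_mul', ← inv_zpow,
      ← inv_zpow]
  rw [← h, ← (commute_of_mem_commutator hZ (commutatorElement_mem _ _) _).eq]
  simp only [commutatorElement_def]; group

theorem pow_val_add {p : ℕ} [NeZero p] {g : G} (hg : g ^ p = 1) (s t : ZMod p) :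
    g ^ (s + t).val = g ^ s.val * g ^ t.val := by
  rw [ZMod.val_add, ← pow_add, ← pow_eq_pow_mod _ hg]

theorem pow_val_intCast {p : ℕ} [NeZero p] {g : G} (hg : g ^ p = 1) (n : ℤ) :
    g ^ (n : ZMod p).val = g ^ n := by
  rw [← zpow_natCast, ZMod.val_intCast]
  conv_rhs => rw [← Int.emod_add_mul_ediv n p, zpow_add, zpow_mul, zpow_natCast, hg, one_zpow,
    mul_one]

/-- Multiplying two normal forms moves `c` past `b'` and `a'`, and `b` past `a'`; each move costs
one central factor. These three factors are the entries of the cocycle of the model. -/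
theorem collect_central (a a' b b' c c' : G) (x y z x' y' z' X Y Z : Subgroup.center G)
    (hX : c * b' = b' * c * X) (hY : c * a' = a' * c * Y) (hZ : b * a' = a' * b * Z) :
    a * a' * (b * b') * (c * c') * (x * x' * X * (y * y' * Y) * (z * z' * Z)) =
      a * b * c * (x * y * z) * (a' * b' * c' * (x' * y' * z')) := by
  have comm : ∀ (W : Subgroup.center G) (g : G), (W : G) * g = g * W := fun W g =>
    (Subgroup.mem_center_iff.mp W.2 g).symm
  have cl : ∀ (W : Subgroup.center G) (g r : G), (W : G) * (g * r) = g * (W * r) := fun W g r => by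
    rw [← mul_assoc, comm, mul_assoc]
  have e : x * x' * X * (y * y' * Y) * (z * z' * Z) = Z * X * Y * (x * y * z) * (x' * y' * z') := by
    ac_rfl
  have e' := congrArg (Subtype.val) e
  simp only [Subgroup.coe_mul] at e'
  rw [e']
  have h1 : (x * y * z : G) * (a' * b' * c' * (x' * y' * z')) =
      a' * b' * c' * ((x * y * z : Subgroup.center G) * (x' * y' * z')) := by
    rw [← mul_assoc, ← Subgroup.coe_mul, ← Subgroup.coe_mul, comm, mul_assoc]
  rw [mul_assoc (a * b * c), h1]
  calc _ = a * (a' * b * Z) * (b' * c * X) * Y * c' * ((x * y * z : Subgroup.center G) * (x' * y' * z')) := by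
        simp only [mul_assoc, Subgroup.coe_mul, cl Z b', cl Z c, cl Z c', cl X c', cl Y c']
    _ = a * b * (a' * c * Y) * b' * c' * ((x * y * z : Subgroup.center G) * (x' * y' * z')) := by
        rw [← hX, ← hZ]
        simp only [mul_assoc, cl Y b', cl Y c']
    _ = _ := by
        rw [← hY]
        simp only [mul_assoc]

end ClassTwo

/-- The free object on three generators among the groups of class two whose derived subgroup has
exponent `p`. -/
@[ext]
structure Model (p : ℕ) where
  u : Fin 3 → ℤ
  s : Fin 3 → ZMod p

/-! ### The free model and its universal property -/

namespace Model

variable {p : ℕ}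

/-- Reduction of integer vectors modulo `p`. -/
def red (p : ℕ) (u : Fin 3 → ℤ) : Fin 3 → ZMod p := fun i => (u i : ZMod p)

/-- The bilinear cocycle defining the multiplication. -/
def cocycle (u v : Fin 3 → ZMod p) : Fin 3 → ZMod p :=
  ![-(u 2 * v 1), u 2 * v 0, -(u 1 * v 0)]

instance : Mul (Model p) := ⟨fun k l => ⟨k.u + l.u, k.s + l.s + cocycle (red p k.u) (red p l.u)⟩⟩
instance : One (Model p) := ⟨⟨0, 0⟩⟩
instance : Inv (Model p) := ⟨fun k => ⟨-k.u, -k.s + cocycle (red p k.u) (red p k.u)⟩⟩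

@[simp] theorem mul_u (k l : Model p) : (k * l).u = k.u + l.u := rfl
@[simp] theorem mul_s (k l : Model p) :
    (k * l).s = k.s + l.s + cocycle (red p k.u) (red p l.u) := rfl
@[simp] theorem one_u : (1 : Model p).u = 0 := rfl
@[simp] theorem one_s : (1 : Model p).s = 0 := rfl
@[simp] theorem inv_u (k : Model p) : (k⁻¹).u = -k.u := rfl
@[simp] theorem inv_s (k : Model p) :
    (k⁻¹).s = -k.s + cocycle (red p k.u) (red p k.u) := rfl

instance : Group (Model p) := Group.ofLeftAxioms
  (fun a b c => by
    ext i
    · simp [add_assoc]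
    · fin_cases i <;> simp [cocycle, red] <;> ring)
  (fun a => by
    ext i
    · simp
    · fin_cases i <;> simp [cocycle, red])
  (fun a => by
    ext i
    · simp
    · fin_cases i <;> simp [cocycle, red])

theorem commutatorElement_eq (k l : Model p) :
    ⁅k, l⁆ = ⟨0, crossProduct (red p k.u) (red p l.u)⟩ := by
  rw [commutatorElement_def]
  ext i
  · simp
  · fin_cases i <;> simp [cocycle, red, cross_apply] <;> ring

theorem pow_eq (k : Model p) (n : ℕ) :
    k ^ n = ⟨(n : ℤ) • k.u, (n : ZMod p) • k.s +
      (n.choose 2 : ZMod p) • cocycle (red p k.u) (red p k.u)⟩ := by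
  induction n with
  | zero => ext i <;> simp
  | succ n ih =>
    rw [pow_succ, ih]
    ext i
    · simp; ring
    · fin_cases i <;> simp [cocycle, red, Nat.choose_succ_succ' n 1, Pi.smul_apply, -Matrix.smul_cons] <;> ring

/-- The central subgroup of the model. -/
def central (p : ℕ) : Multiplicative (Fin 3 → ZMod p) →* Model p where
  toFun s := ⟨0, s.toAdd⟩
  map_one' := rfl
  map_mul' s t := by
    ext i
    · simp
    · fin_cases i <;> simp [cocycle, red]

/-- The generators of the model. -/
def gen (p : ℕ) (i : Fin 3) : Model p := ⟨Pi.single i 1, 0⟩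

theorem gen_zpow (i : Fin 3) (n : ℤ) : gen p i ^ n = ⟨Pi.single i n, 0⟩ := by
  have key : ∀ n : ℕ, gen p i ^ n = ⟨Pi.single i (n : ℤ), 0⟩ := by
    intro n
    rw [pow_eq]
    ext j
    · simp [gen, Pi.single_apply]
    · fin_cases i <;> fin_cases j <;> simp [gen, cocycle, red]
  obtain ⟨n, rfl | rfl⟩ := n.eq_nat_or_neg
  · rw [zpow_natCast, key]
  · rw [zpow_neg, zpow_natCast, key]
    ext j
    · simp [Pi.single_neg]
    · fin_cases i <;> fin_cases j <;> simp [cocycle, red]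

theorem eq_gen_zpow_mul (k : Model p) :
    k = gen p 0 ^ k.u 0 * gen p 1 ^ k.u 1 * gen p 2 ^ k.u 2 *
      central p (Multiplicative.ofAdd k.s) := by
  simp only [gen_zpow]
  ext i
  · fin_cases i <;> simp [central]
  · fin_cases i <;> simp [central, cocycle, red, Matrix.vecHead, Matrix.vecTail]

theorem central_eq [NeZero p] (s : Multiplicative (Fin 3 → ZMod p)) :
    central p s = ⁅gen p 1, gen p 2⁆ ^ (s.toAdd 0).val * ⁅gen p 2, gen p 0⁆ ^ (s.toAdd 1).val *
      ⁅gen p 0, gen p 1⁆ ^ (s.toAdd 2).val := by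
  simp only [commutatorElement_eq, pow_eq]
  ext i
  · simp [central]
  · fin_cases i <;> simp [central, cocycle, red, gen, cross_apply]

theorem closure_gen [NeZero p] : Subgroup.closure (Set.range (gen p)) = ⊤ := by
  have hg : ∀ i, gen p i ∈ Subgroup.closure (Set.range (gen p)) := fun i =>
    Subgroup.subset_closure ⟨i, rfl⟩
  have hc : ∀ i j, ⁅gen p i, gen p j⁆ ∈ Subgroup.closure (Set.range (gen p)) := fun i j =>
    mul_mem (mul_mem (mul_mem (hg i) (hg j)) (inv_mem (hg i))) (inv_mem (hg j))
  refine eq_top_iff.mpr fun k _ => ?_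
  rw [eq_gen_zpow_mul k, central_eq]
  exact mul_mem (mul_mem (mul_mem (zpow_mem (hg _) _) (zpow_mem (hg _) _)) (zpow_mem (hg _) _))
    (mul_mem (mul_mem (pow_mem (hc _ _) _) (pow_mem (hc _ _) _)) (pow_mem (hc _ _) _))

section Lift

variable {G : Type*} [Group G] [NeZero p]

/-- The universal property of the model. -/
def lift (hZ : commutator G ≤ Subgroup.center G) (hp : ∀ g ∈ commutator G, g ^ p = 1)
    (a : Fin 3 → G) : Model p →* G where
  toFun k := a 0 ^ k.u 0 * a 1 ^ k.u 1 * a 2 ^ k.u 2 *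
    (⁅a 1, a 2⁆ ^ (k.s 0).val * ⁅a 2, a 0⁆ ^ (k.s 1).val * ⁅a 0, a 1⁆ ^ (k.s 2).val)
  map_one' := by simp
  map_mul' k l := by
    have hx := commutatorElement_mem (a 1) (a 2)
    have hy := commutatorElement_mem (a 2) (a 0)
    have hz := commutatorElement_mem (a 0) (a 1)
    have c0 : ((k * l).s 0) = k.s 0 + l.s 0 + ((-(k.u 2 * l.u 1) : ℤ) : ZMod p) := by
      simp [cocycle, red]
    have c1 : ((k * l).s 1) = k.s 1 + l.s 1 + ((k.u 2 * l.u 0 : ℤ) : ZMod p) := by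
      simp [cocycle, red]
    have c2 : ((k * l).s 2) = k.s 2 + l.s 2 + ((-(k.u 1 * l.u 0) : ℤ) : ZMod p) := by
      simp [cocycle, red]
    rw [c0, c1, c2, pow_val_add (hp _ hx), pow_val_add (hp _ hx), pow_val_intCast (hp _ hx),
      pow_val_add (hp _ hy), pow_val_add (hp _ hy), pow_val_intCast (hp _ hy),
      pow_val_add (hp _ hz), pow_val_add (hp _ hz), pow_val_intCast (hp _ hz)]
    have e21 := zpow_mul_zpow_comm hZ (a 2) (a 1) (k.u 2) (l.u 1)
    have e20 := zpow_mul_zpow_comm hZ (a 2) (a 0) (k.u 2) (l.u 0)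
    have e10 := zpow_mul_zpow_comm hZ (a 1) (a 0) (k.u 1) (l.u 0)
    rw [← commutatorElement_inv, inv_zpow, ← zpow_neg] at e21 e10
    have hC := fun (g h : G) => hZ (commutatorElement_mem g h)
    simp only [mul_u, Pi.add_apply, zpow_add]
    exact collect_central _ _ _ _ _ _ ⟨_, pow_mem (hC _ _) _⟩ ⟨_, pow_mem (hC _ _) _⟩
      ⟨_, pow_mem (hC _ _) _⟩ ⟨_, pow_mem (hC _ _) _⟩ ⟨_, pow_mem (hC _ _) _⟩
      ⟨_, pow_mem (hC _ _) _⟩ ⟨_, zpow_mem (hC _ _) _⟩ ⟨_, zpow_mem (hC _ _) _⟩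
      ⟨_, zpow_mem (hC _ _) _⟩ e21 e20 e10

theorem lift_gen (hZ : commutator G ≤ Subgroup.center G) (hp : ∀ g ∈ commutator G, g ^ p = 1)
    (a : Fin 3 → G) (i : Fin 3) : lift hZ hp a (gen p i) = a i := by
  fin_cases i <;> simp [lift, gen]

theorem lift_central (hZ : commutator G ≤ Subgroup.center G)
    (hp : ∀ g ∈ commutator G, g ^ p = 1) (a : Fin 3 → G) (s : Multiplicative (Fin 3 → ZMod p)) :
    lift hZ hp a (central p s) = ⁅a 1, a 2⁆ ^ (s.toAdd 0).val * ⁅a 2, a 0⁆ ^ (s.toAdd 1).val *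
      ⁅a 0, a 1⁆ ^ (s.toAdd 2).val := by
  simp [lift, central]

end Lift

end Model
end CharMat

/-! ### Quotients of the model by the relators of a matrix -/

namespace CharMat
open Model Matrix

variable {p : ℕ} {m : Fin 3 → ℕ} {w : Matrix (Fin 3) (Fin 3) (ZMod p)}

/-- The relations `a i ^ p ^ m i = x ^ w i 0 * y ^ w i 1 * z ^ w i 2` and their consequences, in the
model. -/
def IsRel (m : Fin 3 → ℕ) (w : Matrix (Fin 3) (Fin 3) (ZMod p)) (k : Model p) : Prop :=
  ∃ n : Fin 3 → ℤ, (∀ i, k.u i = p ^ m i * n i) ∧ k.s = -(red p n ᵥ* w)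

theorem red_eq_zero (hm : ∀ i, 1 ≤ m i) {u n : Fin 3 → ℤ} (h : ∀ i, u i = p ^ m i * n i) :
    red p u = 0 := by
  ext i
  have : m i ≠ 0 := Nat.one_le_iff_ne_zero.mp (hm i)
  simp [red, h, zero_pow this]

@[simp] theorem red_zero : red p 0 = 0 := by
  ext; simp [red]

theorem red_add (u v : Fin 3 → ℤ) : red p (u + v) = red p u + red p v := by
  ext i; simp [red]

theorem red_neg (u : Fin 3 → ℤ) : red p (-u) = -red p u := by
  ext i; simp [red]

@[simp] theorem cocycle_zero_left (v : Fin 3 → ZMod p) : cocycle 0 v = 0 := by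
  ext i; fin_cases i <;> simp [cocycle]

@[simp] theorem cocycle_zero_right (v : Fin 3 → ZMod p) : cocycle v 0 = 0 := by
  ext i; fin_cases i <;> simp [cocycle]

/-- The subgroup of the model given by the relations. -/
def relSubgroup (hm : ∀ i, 1 ≤ m i) (w : Matrix (Fin 3) (Fin 3) (ZMod p)) : Subgroup (Model p) where
  carrier := {k | IsRel m w k}
  one_mem' := ⟨0, by simp, by simp⟩
  mul_mem' := by
    rintro k l ⟨n, hn, hs⟩ ⟨n', hn', hs'⟩
    refine ⟨n + n', fun i => by simp [hn, hn']; ring, ?_⟩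
    rw [mul_s, hs, hs', red_eq_zero hm hn, red_add, add_vecMul, cocycle_zero_left]
    abel
  inv_mem' := by
    rintro k ⟨n, hn, hs⟩
    refine ⟨-n, fun i => by simp [hn], ?_⟩
    rw [inv_s, hs, red_eq_zero hm hn, red_neg, neg_vecMul, cocycle_zero_left]
    abel

theorem mem_relSubgroup (hm : ∀ i, 1 ≤ m i) {k : Model p} :
    k ∈ relSubgroup hm w ↔ IsRel m w k := Iff.rfl

theorem commute_of_red_eq_zero {k : Model p} (h : red p k.u = 0) (l : Model p) : k * l = l * k := by
  ext i
  · simp [add_comm]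
  · simp [h, add_comm]

instance (hm : ∀ i, 1 ≤ m i) : (relSubgroup hm w).Normal := ⟨by
  intro k hk l
  obtain ⟨n, hn, hs⟩ := hk
  rw [← commute_of_red_eq_zero (red_eq_zero hm hn), mul_inv_cancel_right]
  exact ⟨n, hn, hs⟩⟩

/-- `q` exhibits `G` as the quotient of the model by the relations given by `w`. -/
structure Presents (m : Fin 3 → ℕ) (w : Matrix (Fin 3) (Fin 3) (ZMod p)) {G : Type*} [Group G]
    (q : Model p →* G) : Prop where
  surjective : Function.Surjective q
  eq_one_iff : ∀ k, q k = 1 ↔ IsRel m w k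

theorem isCoatom_of_prime_index {G : Type*} [Group G] {H : Subgroup G} (h : H.index.Prime) :
    IsCoatom H := by
  refine ⟨fun e => h.one_lt.ne' (by simp [e]), fun K hK => ?_⟩
  have e := Subgroup.relIndex_mul_index hK.le
  rcases (Nat.dvd_prime h).mp (Dvd.intro_left _ e) with h1 | h1
  · exact Subgroup.index_eq_one.mp h1
  · rw [h1] at e
    have := Nat.eq_of_mul_eq_mul_right h.pos (e.trans (one_mul _).symm)
    exact absurd (Subgroup.relIndex_eq_one.mp this) hK.not_ge

theorem InClass.card_eq [Fact p.Prime] {G : Type*} [Group G] [Finite G] (h : InClass p m G) :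
    Nat.card G = p ^ (∑ i, m i + 3) := by
  obtain ⟨e⟩ := h.type_eq
  obtain ⟨e'⟩ := h.derived
  rw [Subgroup.card_eq_card_quotient_mul_card_subgroup (commutator G), Nat.card_congr e.toEquiv,
    Nat.card_congr e'.toEquiv, Nat.card_congr Multiplicative.toAdd,
    Nat.card_congr Multiplicative.toAdd, Nat.card_pi, Nat.card_pi, pow_add,
    ← Finset.prod_pow_eq_pow_sum]
  simp

namespace Presents

variable {G : Type*} [Group G] {q : Model p →* G}

/-- Both groups are quotients of the model by the same kernel, so the matrix alone fixes the
isomorphism type. -/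
theorem mulEquiv (h : Presents m w q) {H : Type*} [Group H] {q' : Model p →* H}
    (h' : Presents m w q') : Nonempty (G ≃* H) := by
  have e : q.ker = q'.ker := by
    ext k
    rw [MonoidHom.mem_ker, MonoidHom.mem_ker, h.eq_one_iff, h'.eq_one_iff]
  exact ⟨(QuotientGroup.quotientKerEquivOfSurjective q h.surjective).symm.trans
    ((QuotientGroup.quotientMulEquivOfEq e).trans
      (QuotientGroup.quotientKerEquivOfSurjective q' h'.surjective))⟩

theorem comp_mulEquiv (h : Presents m w q) {H : Type*} [Group H] (e : G ≃* H) :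
    Presents m w (e.toMonoidHom.comp q) where
  surjective := e.surjective.comp h.surjective
  eq_one_iff k := by simp [h.eq_one_iff]

/-- A relator with zero exponent vector has `n = 0` and is trivial, so the relations do not collapse
the derived subgroup. -/
theorem apply_central_injective [NeZero p] (h : Presents m w q) :
    Function.Injective (q.comp (central p)) := by
  rw [injective_iff_map_eq_one]
  intro s hs
  obtain ⟨n, hn, hs⟩ := (h.eq_one_iff _).mp hs
  have : n = 0 := by
    ext i
    have := hn i
    simpa [central, NeZero.ne p] using this
  subst this
  simpa [central] using hs

/-- The projection onto the abelianization. -/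
theorem exists_proj (h : Presents m w q) :
    ∃ f : G →* Multiplicative (∀ i, ZMod (p ^ m i)),
      ∀ k, f (q k) = Multiplicative.ofAdd fun i => ((k.u i : ℤ) : ZMod (p ^ m i)) := by
  let g : Model p →* Multiplicative (∀ i, ZMod (p ^ m i)) :=
    { toFun := fun k => Multiplicative.ofAdd fun i => ((k.u i : ℤ) : ZMod (p ^ m i))
      map_one' := by
        rw [← ofAdd_zero]; congr 1; ext i; simp
      map_mul' := fun k l => by
        rw [← ofAdd_add]; congr 1; ext i; simp }
  have hg : q.ker ≤ g.ker := by
    intro k hk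
    obtain ⟨n, hn, _⟩ := (h.eq_one_iff k).mp hk
    change Multiplicative.ofAdd _ = Multiplicative.ofAdd 0
    congr 1
    ext i
    have : ((p : ZMod (p ^ m i)) ^ m i) = 0 := by exact_mod_cast ZMod.natCast_self (p ^ m i)
    simp [hn, this]
  exact ⟨q.liftOfSurjective h.surjective ⟨g, hg⟩, fun k =>
    DFunLike.congr_fun (MonoidHom.liftOfRightInverse_comp q _ (Function.rightInverse_surjInv h.surjective) ⟨g, hg⟩) k⟩

theorem mem_commutator_iff [NeZero p] (h : Presents m w q) (k : Model p) :
    q k ∈ commutator G ↔ ∀ i, (p : ℤ) ^ m i ∣ k.u i := by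
  constructor
  · intro hk i
    obtain ⟨f, hf⟩ := h.exists_proj
    have := Abelianization.commutator_subset_ker f hk
    rw [MonoidHom.mem_ker, hf] at this
    have := congrFun (Multiplicative.ofAdd.injective this) i
    have := (ZMod.intCast_zmod_eq_zero_iff_dvd (k.u i) (p ^ m i)).mp this
    exact_mod_cast this
  · intro hk
    choose n hn using hk
    have hv : ∀ s, q (central p s) ∈ commutator G := by
      intro s
      rw [central_eq]
      simp only [map_mul, map_pow, map_commutatorElement]
      exact mul_mem (mul_mem (pow_mem (commutatorElement_mem _ _) _)
        (pow_mem (commutatorElement_mem _ _) _)) (pow_mem (commutatorElement_mem _ _) _)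
    -- Splits off the relator with the same exponents as `k`; what remains is a product of
    -- commutators.
    have e : k = central p (Multiplicative.ofAdd (k.s + (red p n ᵥ* w))) *
        ⟨k.u, -(red p n ᵥ* w)⟩ := by
      ext i
      · simp [central]
      · simp [central]
    rw [e, map_mul, (h.eq_one_iff ⟨k.u, -(red p n ᵥ* w)⟩).mpr ⟨n, hn, rfl⟩, mul_one]
    exact hv _

theorem commutator_eq_range [NeZero p] (hm : ∀ i, 1 ≤ m i) (h : Presents m w q) :
    (q.comp (central p)).range = commutator G := by
  ext g
  constructor
  · rintro ⟨s, rfl⟩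
    refine (h.mem_commutator_iff _).mpr fun i => ?_
    simp [central]
  · intro hg
    obtain ⟨k, rfl⟩ := h.surjective g
    have := (h.mem_commutator_iff _).mp hg
    choose n hn using this
    refine ⟨Multiplicative.ofAdd (k.s + (red p n ᵥ* w)), ?_⟩
    rw [MonoidHom.comp_apply, ← mul_inv_eq_one, ← map_inv, ← map_mul, h.eq_one_iff]
    refine ⟨-n, fun i => by simp [central, hn], ?_⟩
    have e : red p (fun i => p ^ m i * n i) = 0 := red_eq_zero hm (n := n) fun i => rfl
    have hu : k.u = fun i => p ^ m i * n i := funext hn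
    simp [central, red_neg, neg_vecMul, hu, e]

theorem type_eq [NeZero p] (h : Presents m w q) :
    Nonempty ((G ⧸ commutator G) ≃* Multiplicative ((i : Fin 3) → ZMod (p ^ m i))) := by
  obtain ⟨f, hf⟩ := h.exists_proj
  have hs : Function.Surjective f := by
    intro t
    choose u hu using fun i => ZMod.intCast_surjective (t.toAdd i)
    refine ⟨q ⟨u, 0⟩, ?_⟩
    rw [hf]
    exact congrArg Multiplicative.ofAdd (funext hu)
  have hk : commutator G = f.ker := by
    refine le_antisymm (Abelianization.commutator_subset_ker f) fun g hg => ?_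
    obtain ⟨k, rfl⟩ := h.surjective g
    rw [MonoidHom.mem_ker, hf] at hg
    refine (h.mem_commutator_iff k).mpr fun i => ?_
    have := congrFun (Multiplicative.ofAdd.injective hg) i
    have := (ZMod.intCast_zmod_eq_zero_iff_dvd (k.u i) (p ^ m i)).mp this
    exact_mod_cast this
  exact ⟨(QuotientGroup.quotientMulEquivOfEq hk).trans
    (QuotientGroup.quotientKerEquivOfSurjective f hs)⟩

theorem derived [NeZero p] (hm : ∀ i, 1 ≤ m i) (h : Presents m w q) :
    Nonempty (commutator G ≃* Multiplicative (Fin 3 → ZMod p)) :=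
  ⟨((MonoidHom.ofInjective h.apply_central_injective).trans
    (MulEquiv.subgroupCongr (h.commutator_eq_range hm))).symm⟩

theorem finite [NeZero p] (hm : ∀ i, 1 ≤ m i) (h : Presents m w q) : Finite G := by
  obtain ⟨e⟩ := h.type_eq
  obtain ⟨e'⟩ := h.derived hm
  have : ∀ i, NeZero (p ^ m i) := fun i => inferInstance
  have : ∀ i, Finite (ZMod (p ^ m i)) := fun i => inferInstance
  have : Finite (Multiplicative ((i : Fin 3) → ZMod (p ^ m i))) :=
    inferInstanceAs (Finite ((i : Fin 3) → ZMod (p ^ m i)))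
  have : Finite (Multiplicative (Fin 3 → ZMod p)) := inferInstanceAs (Finite (Fin 3 → ZMod p))
  have h1 := Finite.of_equiv _ e.symm.toEquiv
  have h2 := Finite.of_equiv _ e'.symm.toEquiv
  exact Finite.of_equiv _ (Subgroup.groupEquivQuotientProdSubgroup (s := commutator G)).symm

theorem apply_mem_center (h : Presents m w q) {k : Model p} (hk : red p k.u = 0) :
    q k ∈ Subgroup.center G := by
  rw [Subgroup.mem_center_iff]
  intro g
  obtain ⟨l, rfl⟩ := h.surjective g
  rw [← map_mul, ← map_mul, commute_of_red_eq_zero hk]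

/-- The coordinates modulo `p`. -/
theorem exists_coord (hm : ∀ i, 1 ≤ m i) (h : Presents m w q) :
    ∃ f : G →* Multiplicative (Fin 3 → ZMod p),
      ∀ k, f (q k) = Multiplicative.ofAdd (red p k.u) := by
  let g : Model p →* Multiplicative (Fin 3 → ZMod p) :=
    { toFun := fun k => Multiplicative.ofAdd (red p k.u)
      map_one' := by
        rw [← ofAdd_zero]; congr 1; ext i; simp [red]
      map_mul' := fun k l => by
        rw [← ofAdd_add]; congr 1; ext i; simp [red] }
  have hg : q.ker ≤ g.ker := by
    intro k hk
    obtain ⟨n, hn, _⟩ := (h.eq_one_iff k).mp hk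
    change Multiplicative.ofAdd _ = Multiplicative.ofAdd 0
    rw [red_eq_zero hm hn]
  exact ⟨q.liftOfSurjective h.surjective ⟨g, hg⟩, fun k =>
    DFunLike.congr_fun (MonoidHom.liftOfRightInverse_comp q _ (Function.rightInverse_surjInv h.surjective) ⟨g, hg⟩) k⟩

/-- Each coordinate modulo `p` has a kernel of index `p`, hence a maximal subgroup; elements in all
three kernels have exponents divisible by `p` and are central. -/
theorem frattini_le [Fact p.Prime] (hm : ∀ i, 1 ≤ m i) (h : Presents m w q) :
    frattini G ≤ Subgroup.center G := by
  obtain ⟨f, hf⟩ := h.exists_coord hm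
  intro g hg
  obtain ⟨k, rfl⟩ := h.surjective g
  refine h.apply_mem_center (funext fun i => ?_)
  let f' : G →* Multiplicative (ZMod p) :=
    (AddMonoidHom.toMultiplicative (Pi.evalAddMonoidHom (fun _ : Fin 3 => ZMod p) i)).comp f
  have hf' : ∀ k, f' (q k) = Multiplicative.ofAdd (red p k.u i) := fun k => by
    simp only [f', MonoidHom.comp_apply, hf]; rfl
  have hs : Function.Surjective f' := by
    intro t
    obtain ⟨c, hc⟩ := ZMod.intCast_surjective t.toAdd
    refine ⟨q ⟨Pi.single i c, 0⟩, ?_⟩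
    rw [hf']
    simp [red, hc]
  have hco : IsCoatom f'.ker := by
    have : f'.ker.index = p := by
      rw [Subgroup.index_ker, MonoidHom.range_eq_top.mpr hs]
      simp
    exact isCoatom_of_prime_index (by rw [this]; exact Fact.out)
  have := frattini_le_coatom hco hg
  rw [MonoidHom.mem_ker, hf'] at this
  exact Multiplicative.ofAdd.injective this

theorem isPGroup [Fact p.Prime] (h : Presents m w q) : IsPGroup p G := by
  intro g
  obtain ⟨k, rfl⟩ := h.surjective g
  -- The first `∑ i, m i + 1` factors make each exponent a multiple of both `p ^ m i` and `p`. The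
  -- last factor kills the central part, and no cocycle term is left, even for `p = 2`.
  refine ⟨∑ i, m i + 1 + 1, ?_⟩
  have h0 : (p : ZMod p) = 0 := by simp
  have e : ∀ i, (p : ℤ) ^ (∑ i, m i + 1) = p ^ m i * p ^ (∑ i, m i + 1 - m i) := by
    intro i
    rw [← pow_add, Nat.add_sub_cancel' ((Finset.single_le_sum (fun i _ => Nat.zero_le (m i))
      (Finset.mem_univ i)).trans (Nat.le_succ _))]
  rw [pow_succ, pow_mul, ← map_pow, ← map_pow, h.eq_one_iff, pow_eq, pow_eq]
  refine ⟨fun i => p ^ (∑ i, m i + 1 - m i) * k.u i * p, fun i => ?_, ?_⟩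
  · simp only [Nat.cast_pow, Pi.smul_apply, smul_eq_mul, e i]
    ring
  · have h1 : red p (fun i => p ^ (∑ i, m i + 1 - m i) * k.u i * p) = 0 := by
      ext i; simp [red]
    have h2 : red p (((p ^ (∑ i, m i + 1) : ℕ) : ℤ) • k.u) = 0 := by
      ext i; simp [red]
    simp only [h1, h2, h0]
    simp

theorem rank_eq [Fact p.Prime] [Finite G] (hm : ∀ i, 1 ≤ m i) (h : Presents m w q) :
    Group.rank G = 3 := by
  classical
  apply le_antisymm
  · have : Subgroup.closure (↑(Finset.univ.image fun i => q (gen p i)) : Set G) = ⊤ := by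
      have := congrArg (Subgroup.map q) (closure_gen (p := p))
      rw [MonoidHom.map_closure, ← MonoidHom.range_eq_map,
        MonoidHom.range_eq_top.mpr h.surjective, ← Set.range_comp] at this
      simpa [Function.comp_def] using this
    exact (Group.rank_le this).trans (Finset.card_image_le.trans (by simp))
  · obtain ⟨f, hf⟩ := h.exists_coord hm
    have hs : Function.Surjective f := by
      intro t
      choose u hu using fun i => ZMod.intCast_surjective (t.toAdd i)
      refine ⟨q ⟨u, 0⟩, ?_⟩
      rw [hf]
      exact congrArg Multiplicative.ofAdd (funext hu)
    have : Finite (Multiplicative (Fin 3 → ZMod p)) := inferInstanceAs (Finite (Fin 3 → ZMod p))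
    refine le_trans ?_ (Group.rank_le_of_surjective f hs)
    have hd := card_dvd_exponent_pow_rank' (Multiplicative (Fin 3 → ZMod p)) (n := p) (fun g => by
      change Multiplicative.ofAdd (p • g.toAdd) = 1
      rw [← ofAdd_zero]
      congr 1
      ext i
      simp)
    rw [Nat.card_congr Multiplicative.toAdd, Nat.card_pi] at hd
    simp only [Nat.card_zmod, Finset.prod_const, Finset.card_univ, Fintype.card_fin] at hd
    exact (Nat.pow_dvd_pow_iff_le_right (Fact.out : p.Prime).one_lt).mp hd

theorem inClass [Fact p.Prime] [Finite G] (hm : ∀ i, 1 ≤ m i) (h : Presents m w q) :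
    InClass p m G :=
  ⟨h.isPGroup, h.rank_eq hm, h.frattini_le hm, h.derived hm, h.type_eq⟩

theorem isCharGenerators [Fact p.Prime] (h : Presents m w q) :
    IsCharGenerators p m fun i => q (gen p i) := by
  have key : ∀ i (n : ℤ), Abelianization.of (q (gen p i)) ^ n = 1 ↔ (p : ℤ) ^ m i ∣ n := by
    intro i n
    rw [← map_zpow, ← map_zpow, ← MonoidHom.mem_ker, Abelianization.ker_of,
      h.mem_commutator_iff, gen_zpow]
    constructor
    · intro H
      simpa using H i
    · intro H j
      rcases eq_or_ne j i with rfl | hj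
      · simpa using H
      · simp [hj]
  refine ⟨fun i => ?_, ?_, ?_⟩
  · refine Nat.dvd_antisymm (orderOf_dvd_of_pow_eq_one ?_) ?_
    · rw [← zpow_natCast, key]
      simp
    · have := (key i (orderOf (Abelianization.of (q (gen p i))))).mp (by
        rw [zpow_natCast, pow_orderOf_eq_one])
      exact_mod_cast this
  · obtain ⟨f, hf⟩ := h.exists_proj
    rw [iSupIndep_def]
    intro i
    rw [Subgroup.disjoint_def]
    rintro _ ⟨n, rfl⟩ hx
    let π : Abelianization G →* Multiplicative (ZMod (p ^ m i)) :=
      (AddMonoidHom.toMultiplicative (Pi.evalAddMonoidHom _ i)).comp (Abelianization.lift f)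
    have hπ : ∀ k, π (Abelianization.of (q k)) =
        Multiplicative.ofAdd ((k.u i : ℤ) : ZMod (p ^ m i)) := fun k => by
      simp only [π, MonoidHom.comp_apply, Abelianization.lift_apply_of, hf]; rfl
    have hle : ⨆ j, ⨆ (_ : j ≠ i), Subgroup.zpowers (Abelianization.of (q (gen p j))) ≤ π.ker := by
      refine iSup₂_le fun j hj => ?_
      rw [Subgroup.zpowers_le, MonoidHom.mem_ker, hπ]
      simp [gen, hj.symm]
    have hx := hle hx
    change _ ^ n = _
    change _ ^ n ∈ _ at hx
    rw [MonoidHom.mem_ker, ← map_zpow, ← map_zpow, hπ, gen_zpow] at hx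
    rw [key]
    have := (ZMod.intCast_zmod_eq_zero_iff_dvd _ (p ^ m i)).mp (Multiplicative.ofAdd.injective hx)
    simpa using this
  · refine eq_top_iff.mpr fun x _ => ?_
    obtain ⟨g, rfl⟩ := QuotientGroup.mk_surjective x
    obtain ⟨k, rfl⟩ := h.surjective g
    have : Subgroup.closure (Set.range (gen p)) ≤ ((⨆ i, Subgroup.zpowers
        (Abelianization.of (q (gen p i)))).comap (Abelianization.of.comp q)) := by
      rw [Subgroup.closure_le]
      rintro _ ⟨i, rfl⟩
      exact (le_iSup (fun i => Subgroup.zpowers (Abelianization.of (q (gen p i)))) i)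
        (Subgroup.mem_zpowers _)
    rw [closure_gen] at this
    exact this (Subgroup.mem_top k)

theorem gen_pow_mul_inv_isRel (w : Matrix (Fin 3) (Fin 3) (ZMod p)) (i : Fin 3) :
    IsRel m w (gen p i ^ p ^ m i * (central p (Multiplicative.ofAdd (w i)))⁻¹) := by
  refine ⟨Pi.single i 1, fun j => ?_, ?_⟩
  · rw [← zpow_natCast, gen_zpow]
    rcases eq_or_ne j i with rfl | hj
    · simp [central]
    · simp [central, hj]
  · have : red p (Pi.single i 1) = Pi.single i 1 := by
      ext j
      rcases eq_or_ne j i with rfl | hj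
      · simp [red]
      · simp [red, hj]
    rw [← zpow_natCast, gen_zpow, this]
    simp [central]
    rfl

theorem isCharMatrix [Fact p.Prime] (h : Presents m w q) :
    IsCharMatrix p m G w := by
  refine ⟨_, h.isCharGenerators, fun i => ?_⟩
  have := (h.eq_one_iff _).mpr (gen_pow_mul_inv_isRel w i)
  rw [map_mul, map_inv, mul_inv_eq_one, central_eq] at this
  simpa using this

end Presents
end CharMat

/-! ### Groups of the class as quotients of the model -/

namespace CharMat
open Model Matrix

variable {p : ℕ} {m : Fin 3 → ℕ} {w w' : Matrix (Fin 3) (Fin 3) (ZMod p)}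

theorem presents_mk (hm : ∀ i, 1 ≤ m i) (w : Matrix (Fin 3) (Fin 3) (ZMod p)) :
    Presents m w (QuotientGroup.mk' (relSubgroup hm w)) where
  surjective := QuotientGroup.mk'_surjective _
  eq_one_iff k := by
    rw [← MonoidHom.mem_ker, QuotientGroup.ker_mk', mem_relSubgroup]

/-- A maximal subgroup `M` is normal by nilpotency. The preimage of the nontrivial centre of `G ⧸ M`
is strictly larger than `M`, hence everything, so `G ⧸ M` is abelian. -/
theorem commutator_le_frattini {G : Type*} [Group G] [Finite G] [Fact p.Prime]
    (h : IsPGroup p G) : commutator G ≤ frattini G := by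
  refine le_iInf₂ fun M hM => ?_
  have := h.isNilpotent
  have hn : M.Normal := Subgroup.NormalizerCondition.normal_of_coatom M Group.normalizerCondition_of_isNilpotent hM
  have : Nontrivial (G ⧸ M) := QuotientGroup.nontrivial_iff.mpr hM.1
  have hc := (h.to_quotient M).bot_lt_center
  have hlt : M < (Subgroup.center (G ⧸ M)).comap (QuotientGroup.mk' M) := by
    have := (Subgroup.comap_lt_comap_of_surjective (QuotientGroup.mk'_surjective M)).mpr hc
    rwa [MonoidHom.comap_bot, QuotientGroup.ker_mk'] at this
  have ht := hM.2 _ hlt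
  rw [commutator_def, Subgroup.commutator_le]
  intro a _ b _
  have ha : a ∈ (Subgroup.center (G ⧸ M)).comap (QuotientGroup.mk' M) := ht ▸ Subgroup.mem_top a
  have hb := Subgroup.mem_center_iff.mp (Subgroup.mem_comap.mp ha) (QuotientGroup.mk' M b)
  rw [← QuotientGroup.ker_mk' M, MonoidHom.mem_ker, map_commutatorElement,
    commutatorElement_eq_one_iff_mul_comm, hb]

theorem eq_one_of_isRel [NeZero p] {G : Type*} [Group G] {q : Model p →* G}
    (hq : ∀ i, q (gen p i) ^ p ^ m i = q (central p (Multiplicative.ofAdd (w i)))) {k : Model p}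
    (hk : IsRel m w k) : q k = 1 := by
  obtain ⟨n, hn, hs⟩ := hk
  have e : ∀ i, q (gen p i) ^ k.u i = q (central p (Multiplicative.ofAdd (n i • w i))) := by
    intro i
    rw [hn, _root_.zpow_mul, ofAdd_zsmul, map_zpow, map_zpow, ← hq, ← zpow_natCast, Nat.cast_pow]
  rw [eq_gen_zpow_mul k, map_mul, map_mul, map_mul, map_zpow, map_zpow, map_zpow, e, e, e,
    ← map_mul, ← map_mul, ← map_mul, ← map_mul, ← map_mul, ← map_mul, ← ofAdd_add, ← ofAdd_add,
    ← ofAdd_add, hs]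
  have : n 0 • w 0 + n 1 • w 1 + n 2 • w 2 + -(red p n ᵥ* w) = 0 := by
    ext i
    simp [vecMul, dotProduct, Fin.sum_univ_three, red]
  rw [this, ofAdd_zero, map_one, map_one]

section InClass

variable {G : Type*} [Group G] [Finite G] [Fact p.Prime]

theorem InClass.commutator_le_center (h : InClass p m G) : commutator G ≤ Subgroup.center G :=
  (commutator_le_frattini h.isPGroup).trans h.frattini_le

theorem InClass.pow_eq_one (h : InClass p m G) (g : G) (hg : g ∈ commutator G) : g ^ p = 1 := by
  obtain ⟨e⟩ := h.derived
  have : (⟨g, hg⟩ : commutator G) ^ p = 1 := by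
    apply e.injective
    rw [map_pow, map_one]
    change Multiplicative.ofAdd (p • (e ⟨g, hg⟩).toAdd) = 1
    rw [← ofAdd_zero]
    congr 1
    ext i
    simp
  exact congrArg Subtype.val this

/-- The derived subgroup lies in the Frattini subgroup, so generation can be tested in the
abelianization. -/
theorem InClass.eq_top (h : InClass p m G) {H : Subgroup G}
    (hH : H.map Abelianization.of = ⊤) : H = ⊤ := by
  have h1 : H ⊔ commutator G = ⊤ := by
    have := congrArg (Subgroup.comap Abelianization.of) hH
    rwa [Subgroup.comap_map_eq, Subgroup.comap_top, Abelianization.ker_of] at this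
  refine frattini_nongenerating (eq_top_iff.mpr ?_)
  rw [← h1]
  exact sup_le_sup_left (commutator_le_frattini h.isPGroup) H

/-- A surjection from the model onto a group of the class that satisfies the relations is a
presentation, by counting. -/
theorem InClass.presents (h : InClass p m G) (hm : ∀ i, 1 ≤ m i) {q : Model p →* G}
    (hs : Function.Surjective q) (hq : ∀ k, IsRel m w k → q k = 1) : Presents m w q := by
  refine ⟨hs, fun k => ⟨fun hk => ?_, hq k⟩⟩
  have hP := presents_mk hm w
  have := hP.finite hm
  let f := QuotientGroup.lift (relSubgroup hm w) q fun k hk => hq k hk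
  have hf : Function.Surjective f := fun g => by
    obtain ⟨k, rfl⟩ := hs g
    exact ⟨QuotientGroup.mk' _ k, rfl⟩
  have hb := hf.bijective_of_nat_card_le
    (by rw [h.card_eq, (hP.inClass hm).card_eq])
  refine (hP.eq_one_iff k).mp (hb.1 ?_)
  rw [map_one, ← hk]
  rfl

theorem InClass.exists_presents (h : InClass p m G) (hm : ∀ i, 1 ≤ m i)
    (hw : IsCharMatrix p m G w) : ∃ q : Model p →* G, Presents m w q := by
  obtain ⟨a, ha, hr⟩ := hw
  let q := lift h.commutator_le_center h.pow_eq_one a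
  have hq : ∀ i, q (gen p i) = a i := lift_gen _ _ a
  refine ⟨q, h.presents hm ?_ fun k hk => eq_one_of_isRel (fun i => ?_) hk⟩
  · refine MonoidHom.range_eq_top.mp (h.eq_top (eq_top_iff.mpr ?_))
    rw [← ha.iSup_eq]
    refine iSup_le fun i => ?_
    rw [Subgroup.zpowers_le]
    exact Subgroup.mem_map_of_mem _ ⟨gen p i, hq i⟩
  · rw [hq, hr, lift_central]
    rfl

end InClass

/-- The rows are the cross products of the rows of `C`. -/
def crossMatrix {R : Type*} [CommRing R] (C : Fin 3 → Fin 3 → R) : Matrix (Fin 3) (Fin 3) R :=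
  of ![crossProduct (C 1) (C 2), crossProduct (C 2) (C 0), crossProduct (C 0) (C 1)]

theorem apply_central_eq [NeZero p] {G : Type*} [Group G] {q q' : Model p →* G} {k : Fin 3 → Model p}
    (hk : ∀ i, q' (gen p i) = q (k i)) (s : Fin 3 → ZMod p) :
    q' (central p (Multiplicative.ofAdd s)) =
      q (central p (Multiplicative.ofAdd (s ᵥ* crossMatrix fun i => red p (k i).u))) := by
  have e : central p (Multiplicative.ofAdd (s ᵥ* crossMatrix fun i => red p (k i).u)) =
      ⁅k 1, k 2⁆ ^ (s 0).val * ⁅k 2, k 0⁆ ^ (s 1).val * ⁅k 0, k 1⁆ ^ (s 2).val := by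
    simp only [commutatorElement_eq, pow_eq]
    ext i
    · simp [central]
    · simp [central, crossMatrix, vecHead, vecTail, add_assoc]
  rw [e, central_eq]
  simp [map_commutatorElement, hk]

/-- The change of the characteristic matrix under a change of generators, for type
`(p ^ m₁, p ^ m₂, p ^ m₂)` with `m₂ < m₁`. -/
def Similar {F : Type*} [Field F] (w w' : Matrix (Fin 3) (Fin 3) F) : Prop :=
  ∃ c d₁ d₂ e₁ e₂ k l m n : F, c ≠ 0 ∧ k * n - l * m ≠ 0 ∧
    (c * (k * n - l * m)) • w' =
      !![c, 0, 0; d₁, k, l; d₂, m, n] * w * !![c, 0, 0; e₁, k, m; e₂, l, n]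

/-! ### Change of generators -/

section Change

variable {G : Type*} [Group G] [Fact p.Prime] {m₁ m₂ : ℕ}

/-- Halving costs one factor `2`, so for `p = 2` divisibility by `p` survives only if `a ≥ 2`. This
is where `m₂ > 1` is needed. -/
theorem choose_two_eq_zero {a : ℕ} (ha : 1 ≤ a) (h2 : p = 2 → 1 < a) :
    ((p ^ a).choose 2 : ZMod p) = 0 := by
  rw [ZMod.natCast_eq_zero_iff]
  rcases eq_or_ne p 2 with rfl | hp
  · obtain ⟨b, rfl⟩ : ∃ b, a = b + 2 := ⟨a - 2, by have := h2 rfl; omega⟩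
    rw [Nat.choose_two_right]
    have : 2 ^ (b + 2) * (2 ^ (b + 2) - 1) = 2 * (2 * (2 ^ b * (2 ^ (b + 2) - 1))) := by ring
    rw [this, Nat.mul_div_cancel_left _ (by norm_num)]
    exact Dvd.intro _ rfl
  · have h1 : p ∣ (p ^ a).choose 2 * 2 := by
      rw [Nat.choose_two_right, Nat.div_mul_cancel (Nat.even_mul_pred_self _).two_dvd]
      exact Dvd.dvd.mul_right (dvd_pow_self p (by omega)) _
    exact ((Nat.coprime_primes Fact.out Nat.prime_two).mpr hp).dvd_of_dvd_mul_right h1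

theorem pow_pow_eq {a : ℕ} (ha : 1 ≤ a) (h2 : p = 2 → 1 < a) (k : Model p) :
    k ^ p ^ a = ⟨((p ^ a : ℕ) : ℤ) • k.u, 0⟩ := by
  rw [pow_eq, choose_two_eq_zero ha h2]
  have : a ≠ 0 := by omega
  simp [this]

theorem Presents.similar (hm₂ : 1 ≤ m₂) (hm : m₂ < m₁) (h2 : p = 2 → 1 < m₂) {q q' : Model p →* G}
    (h : Presents ![m₁, m₂, m₂] w q) (h' : Presents ![m₁, m₂, m₂] w' q') : Similar w w' := by
  have hm1 : ∀ i, 1 ≤ ![m₁, m₂, m₂] i := by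
    intro i; fin_cases i <;> simp <;> omega
  have hm2 : ∀ i, p = 2 → 1 < ![m₁, m₂, m₂] i := by
    intro i hp; have := h2 hp; fin_cases i <;> simp <;> omega
  choose k hk using fun i => h.surjective (q' (gen p i))
  set C : Fin 3 → Fin 3 → ZMod p := fun i => red p (k i).u with hC
  have hc := apply_central_eq fun i => (hk i).symm
  have key : ∀ i, IsRel ![m₁, m₂, m₂] w
      (k i ^ p ^ ![m₁, m₂, m₂] i * (central p (Multiplicative.ofAdd (w' i ᵥ* crossMatrix C)))⁻¹) := by
    intro i
    rw [← h.eq_one_iff, map_mul, map_pow, map_inv, hk, ← hc, ← map_pow, ← map_inv, ← map_mul,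
      h'.eq_one_iff]
    exact Presents.gen_pow_mul_inv_isRel w' i
  simp only [pow_pow_eq (hm1 _) (hm2 _)] at key
  choose N hN hD using key
  have hD' : (of fun i => red p (N i)) * w = w' * crossMatrix C := by
    ext i j
    have := congrFun (hD i) j
    simp [central] at this
    exact this.symm
  have hp : (p : ℤ) ≠ 0 := by exact_mod_cast (Fact.out : p.Prime).ne_zero
  have e : ∀ i j, (p : ℤ) ^ (![m₁, m₂, m₂] i) * (k i).u j = p ^ (![m₁, m₂, m₂] j) * N i j := by
    intro i j
    have := hN i j
    simpa [central] using this
  obtain ⟨t, rfl⟩ : ∃ t, m₁ = m₂ + (t + 1) := ⟨m₁ - m₂ - 1, by omega⟩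
  have ediag : ∀ i j, (![m₂ + (t + 1), m₂, m₂] i = ![m₂ + (t + 1), m₂, m₂] j) →
      (N i j : ZMod p) = C i j := by
    intro i j hij
    have := e i j
    rw [hij] at this
    have := mul_left_cancel₀ (pow_ne_zero _ hp) this
    simp [hC, red, this]
  -- The excess `t + 1 = m₁ - m₂` in `e` makes `N 0 j` divisible by `p` here and, read the other
  -- way, `C i 0` in `edown`. This is the source of the triangular shapes.
  have eup : ∀ j, ![m₂ + (t + 1), m₂, m₂] j = m₂ → (N 0 j : ZMod p) = 0 := by
    intro j hj
    have := e 0 j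
    rw [hj, cons_val_zero, pow_add, mul_assoc] at this
    have := mul_left_cancel₀ (pow_ne_zero _ hp) this
    rw [← this]
    simp
  have edown : ∀ i, ![m₂ + (t + 1), m₂, m₂] i = m₂ → C i 0 = 0 := by
    intro i hi
    have := e i 0
    rw [hi, cons_val_zero, pow_add, mul_assoc] at this
    have := mul_left_cancel₀ (pow_ne_zero _ hp) this
    simp [hC, red, this]
  have h10 := edown 1 rfl
  have h20 := edown 2 rfl
  -- Injectivity of `q'` on the central part makes the cofactor matrix invertible; as its
  -- determinant is the square of that of `C`, both diagonal blocks of `C` are invertible.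
  have hdet : (crossMatrix C).det ≠ 0 := by
    rw [Ne, ← exists_vecMul_eq_zero_iff]
    rintro ⟨v, hv, hv0⟩
    apply hv
    have : q' (central p (Multiplicative.ofAdd v)) = 1 := by
      rw [hc, hv0, ofAdd_zero, map_one, map_one]
    exact Multiplicative.ofAdd.injective
      ((injective_iff_map_eq_one _).mp h'.apply_central_injective _ this)
  have hdet' : (crossMatrix C).det = (C 0 0 * (C 1 1 * C 2 2 - C 1 2 * C 2 1)) ^ 2 := by
    simp [crossMatrix, det_fin_three, cross_apply, h10, h20]
    ring
  rw [hdet'] at hdet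
  have hne := ne_zero_pow two_ne_zero hdet
  refine ⟨C 0 0, N 1 0, N 2 0, C 0 1, C 0 2, C 1 1, C 1 2, C 2 1, C 2 2,
    left_ne_zero_of_mul hne, right_ne_zero_of_mul hne, ?_⟩
  have e1 : !![C 0 0, 0, 0; (N 1 0 : ZMod p), C 1 1, C 1 2; (N 2 0 : ZMod p), C 2 1, C 2 2] =
      of fun i => red p (N i) := by
    ext i j
    fin_cases i <;> fin_cases j <;> simp [red]
    · rw [ediag 0 0 rfl]
    · rw [eup 1 rfl]
    · rw [eup 2 rfl]
    · rw [ediag 1 1 rfl]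
    · rw [ediag 1 2 rfl]
    · rw [ediag 2 1 rfl]
    · rw [ediag 2 2 rfl]
  have e2 : crossMatrix C * !![C 0 0, 0, 0; C 0 1, C 1 1, C 2 1; C 0 2, C 1 2, C 2 2] =
      (C 0 0 * (C 1 1 * C 2 2 - C 1 2 * C 2 1)) • (1 : Matrix (Fin 3) (Fin 3) (ZMod p)) := by
    ext i j
    fin_cases i <;> fin_cases j <;>
      simp [crossMatrix, cross_apply, mul_apply, Fin.sum_univ_three, h10, h20] <;> ring
  rw [e1, hD', Matrix.mul_assoc, e2, Matrix.mul_smul, Matrix.mul_one]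

theorem Similar.exists_presents [Finite G] (hm₂ : 1 ≤ m₂) (hm : m₂ < m₁)
    (h2 : p = 2 → 1 < m₂) {q : Model p →* G} (hG : InClass p ![m₁, m₂, m₂] G)
    (h : Presents ![m₁, m₂, m₂] w q) (hw : Similar w w') :
    ∃ q' : Model p →* G, Presents ![m₁, m₂, m₂] w' q' := by
  have hm1 : ∀ i, 1 ≤ ![m₁, m₂, m₂] i := by
    intro i; fin_cases i <;> simp <;> omega
  have hm2 : ∀ i, p = 2 → 1 < ![m₁, m₂, m₂] i := by
    intro i hp; have := h2 hp; fin_cases i <;> simp <;> omega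
  obtain ⟨c, d₁, d₂, e₁, e₂, k, l, r, s, hc, hd, hww⟩ := hw
  obtain ⟨t, rfl⟩ : ∃ t, m₁ = m₂ + (t + 1) := ⟨m₁ - m₂ - 1, by omega⟩
  obtain ⟨c, rfl⟩ := ZMod.intCast_surjective c
  obtain ⟨d₁, rfl⟩ := ZMod.intCast_surjective d₁
  obtain ⟨d₂, rfl⟩ := ZMod.intCast_surjective d₂
  obtain ⟨e₁, rfl⟩ := ZMod.intCast_surjective e₁
  obtain ⟨e₂, rfl⟩ := ZMod.intCast_surjective e₂
  obtain ⟨k, rfl⟩ := ZMod.intCast_surjective k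
  obtain ⟨l, rfl⟩ := ZMod.intCast_surjective l
  obtain ⟨r, rfl⟩ := ZMod.intCast_surjective r
  obtain ⟨s, rfl⟩ := ZMod.intCast_surjective s
  -- The factor `p ^ (t + 1)` turns `p ^ m₂` times the lower first-column entries into `p ^ m₁ * d₁`
  -- and `p ^ m₁ * d₂`; the `d`'s thus enter the powers but not the commutators.
  let C : Matrix (Fin 3) (Fin 3) ℤ :=
    !![c, e₁, e₂; p ^ (t + 1) * d₁, k, l; p ^ (t + 1) * d₂, r, s]
  let q' := lift hG.commutator_le_center hG.pow_eq_one fun i => q ⟨C i, 0⟩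
  have hq' : ∀ i, q' (gen p i) = q ⟨C i, 0⟩ := lift_gen _ _ _
  refine ⟨q', hG.presents hm1 ?_ fun g hg => eq_one_of_isRel (fun i => ?_) hg⟩
  · refine MonoidHom.range_eq_top.mp (hG.eq_top (eq_top_iff.mpr fun x _ => ?_))
    obtain ⟨g, rfl⟩ := QuotientGroup.mk_surjective x
    obtain ⟨⟨u, σ⟩, rfl⟩ := h.surjective g
    have hcop : IsCoprime C.det ((p : ℤ) ^ (m₂ + (t + 1))) := by
      refine IsCoprime.pow_right ?_
      have hp : Prime (p : ℤ) := Nat.prime_iff_prime_int.mp Fact.out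
      rw [isCoprime_comm, hp.coprime_iff_not_dvd]
      intro hdvd
      have h0 := (ZMod.intCast_zmod_eq_zero_iff_dvd C.det p).mpr hdvd
      have e : ((C.det : ℤ) : ZMod p) = c * (k * s - l * r) := by
        simp [C, det_fin_three]
        ring
      rw [e] at h0
      exact mul_ne_zero hc hd h0
    obtain ⟨a, b, hab⟩ := hcop
    -- The adjugate inverts `C` modulo `p ^ m₁`, so the new generators reach every exponent vector
    -- modulo `G'`.
    set v : Fin 3 → ℤ := a • (u ᵥ* C.adjugate) with hv
    have hvC : v ᵥ* C = u + ((p : ℤ) ^ (m₂ + (t + 1))) • (-b • u) := by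
      rw [hv, smul_vecMul, vecMul_vecMul, adjugate_mul, vecMul_smul, vecMul_one]
      ext i
      simp only [Pi.smul_apply, Pi.add_apply, smul_eq_mul]
      linear_combination u i * hab
    refine ⟨q' ⟨v, 0⟩, ⟨_, rfl⟩, ?_⟩
    have hrow : q' ⟨v, 0⟩ = q (⟨C 0, 0⟩ ^ v 0 * ⟨C 1, 0⟩ ^ v 1 * ⟨C 2, 0⟩ ^ v 2) := by
      rw [eq_gen_zpow_mul ⟨v, 0⟩]
      simp [hq']
    have hu : ∀ (k : Model p) (n : ℤ), (k ^ n).u = n • k.u := by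
      intro k n
      obtain ⟨n, rfl | rfl⟩ := n.eq_nat_or_neg
      · rw [zpow_natCast, pow_eq]
      · rw [_root_.zpow_neg, zpow_natCast, inv_u, pow_eq, neg_smul]
    rw [hrow]
    change Abelianization.of _ = Abelianization.of _
    rw [← mul_inv_eq_one, ← map_inv, ← map_mul, ← map_inv, ← map_mul, ← MonoidHom.mem_ker,
      Abelianization.ker_of, h.mem_commutator_iff]
    intro i
    have hi := congrFun hvC i
    simp only [vecMul, dotProduct, Fin.sum_univ_three, Pi.add_apply, Pi.smul_apply,
      smul_eq_mul] at hi
    have hle : ![m₂ + (t + 1), m₂, m₂] i ≤ m₂ + (t + 1) := by fin_cases i <;> simp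
    refine (pow_dvd_pow (p : ℤ) hle).trans ⟨-b * u i, ?_⟩
    simp only [mul_u, hu, inv_u, Pi.add_apply, Pi.smul_apply, Pi.neg_apply, smul_eq_mul]
    linear_combination hi
  · rw [apply_central_eq hq', hq', ← map_pow, ← mul_inv_eq_one, ← map_inv, ← map_mul,
      h.eq_one_iff, pow_pow_eq (hm1 i) (hm2 i)]
    let N : Matrix (Fin 3) (Fin 3) ℤ :=
      !![c, p ^ (t + 1) * e₁, p ^ (t + 1) * e₂; d₁, k, l; d₂, r, s]
    have hcross : w' * crossMatrix (fun i => red p (C i)) = (of fun i => red p (N i)) * w := by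
      have e1 : !![(c : ZMod p), 0, 0; (d₁ : ZMod p), k, l; (d₂ : ZMod p), r, s] =
          of fun i => red p (N i) := by
        ext i j
        fin_cases i <;> fin_cases j <;> simp [red, N]
      have e2 : !![(c : ZMod p), 0, 0; (e₁ : ZMod p), k, r; (e₂ : ZMod p), l, s] *
          crossMatrix (fun i => red p (C i)) =
          ((c : ZMod p) * (k * s - l * r)) • (1 : Matrix (Fin 3) (Fin 3) (ZMod p)) := by
        ext i j
        fin_cases i <;> fin_cases j <;>
          simp [crossMatrix, cross_apply, mul_apply, Fin.sum_univ_three, red, C] <;> ring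
      have := congrArg (· * crossMatrix (fun i => red p (C i))) hww
      simp only [Matrix.smul_mul, Matrix.mul_assoc, e2, e1, Matrix.mul_smul, Matrix.mul_one] at this
      exact smul_right_injective _ (mul_ne_zero hc hd) this
    refine ⟨N i, fun j => ?_, ?_⟩
    · fin_cases i <;> fin_cases j <;> simp [central, C, N] <;> ring
    · have := congrFun hcross i
      simp [central]
      exact this

end Change
end CharMat

/-! ### Elementary moves on matrices -/

namespace CharMat
open Matrix

section Field

variable {F : Type*} [Field F]

/-- Entrywise form of the defining identity, with the common factor `c` cancelled in the first row.
-/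
theorem similar_of_eq {α β₁ β₂ γ₁ γ₂ a b a' b' : F} {α' β₁' β₂' γ₁' γ₂' x y x' y' : F}
    (c d₁ d₂ e₁ e₂ k l m n : F) (hc : c ≠ 0) (hd : k * n - l * m ≠ 0)
    (h00 : (k * n - l * m) * α' = α * c + β₁ * e₁ + β₂ * e₂)
    (h01 : (k * n - l * m) * β₁' = β₁ * k + β₂ * l)
    (h02 : (k * n - l * m) * β₂' = β₁ * m + β₂ * n)
    (h10 : c * (k * n - l * m) * γ₁' = (d₁ * α + k * γ₁ + l * γ₂) * c +
      (d₁ * β₁ + k * a + l * a') * e₁ + (d₁ * β₂ + k * b + l * b') * e₂)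
    (h11 : c * (k * n - l * m) * x =
      (d₁ * β₁ + k * a + l * a') * k + (d₁ * β₂ + k * b + l * b') * l)
    (h12 : c * (k * n - l * m) * y =
      (d₁ * β₁ + k * a + l * a') * m + (d₁ * β₂ + k * b + l * b') * n)
    (h20 : c * (k * n - l * m) * γ₂' = (d₂ * α + m * γ₁ + n * γ₂) * c +
      (d₂ * β₁ + m * a + n * a') * e₁ + (d₂ * β₂ + m * b + n * b') * e₂)
    (h21 : c * (k * n - l * m) * x' =
      (d₂ * β₁ + m * a + n * a') * k + (d₂ * β₂ + m * b + n * b') * l)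
    (h22 : c * (k * n - l * m) * y' =
      (d₂ * β₁ + m * a + n * a') * m + (d₂ * β₂ + m * b + n * b') * n) :
    Similar !![α, β₁, β₂; γ₁, a, b; γ₂, a', b'] !![α', β₁', β₂'; γ₁', x, y; γ₂', x', y'] := by
  refine ⟨c, d₁, d₂, e₁, e₂, k, l, m, n, hc, hd, ?_⟩
  ext i j
  fin_cases i <;> fin_cases j <;> simp [mul_apply, Fin.sum_univ_three]
  · linear_combination c * h00
  · linear_combination c * h01
  · linear_combination c * h02
  · linear_combination h10
  · linear_combination h11
  · linear_combination h12
  · linear_combination h20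
  · linear_combination h21
  · linear_combination h22

theorem Similar.trans {w w' w'' : Matrix (Fin 3) (Fin 3) F} (h : Similar w w')
    (h' : Similar w' w'') : Similar w w'' := by
  obtain ⟨c, d₁, d₂, e₁, e₂, k, l, m, n, hc, hd, h⟩ := h
  obtain ⟨c', d₁', d₂', e₁', e₂', k', l', m', n', hc', hd', h'⟩ := h'
  refine ⟨c' * c, d₁' * c + k' * d₁ + l' * d₂, d₂' * c + m' * d₁ + n' * d₂,
    c' * e₁ + e₁' * k + e₂' * m, c' * e₂ + e₁' * l + e₂' * n,
    k' * k + l' * m, k' * l + l' * n, m' * k + n' * m, m' * l + n' * n, mul_ne_zero hc' hc, ?_, ?_⟩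
  · convert mul_ne_zero hd' hd using 1
    ring
  · have e1 : !![c' * c, 0, 0; d₁' * c + k' * d₁ + l' * d₂, k' * k + l' * m, k' * l + l' * n;
        d₂' * c + m' * d₁ + n' * d₂, m' * k + n' * m, m' * l + n' * n] =
        !![c', 0, 0; d₁', k', l'; d₂', m', n'] * !![c, 0, 0; d₁, k, l; d₂, m, n] := by
      ext i j
      fin_cases i <;> fin_cases j <;> simp [mul_apply, Fin.sum_univ_three]
    have e2 : !![c' * c, 0, 0; c' * e₁ + e₁' * k + e₂' * m, k' * k + l' * m, m' * k + n' * m;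
        c' * e₂ + e₁' * l + e₂' * n, k' * l + l' * n, m' * l + n' * n] =
        !![c, 0, 0; e₁, k, m; e₂, l, n] * !![c', 0, 0; e₁', k', m'; e₂', l', n'] := by
      ext i j
      fin_cases i <;> fin_cases j <;> simp [mul_apply, Fin.sum_univ_three] <;> ring
    rw [e1, e2]
    calc _ = (c * (k * n - l * m)) • ((c' * (k' * n' - l' * m')) • w'') := by
          rw [smul_smul]
          congr 1
          ring
      _ = !![c', 0, 0; d₁', k', l'; d₂', m', n'] * ((c * (k * n - l * m)) • w') *
          !![c', 0, 0; e₁', k', m'; e₂', l', n'] := by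
          rw [h', Matrix.mul_smul, Matrix.smul_mul]
      _ = _ := by
          rw [h]
          simp only [Matrix.mul_assoc]

/-- `B * M * Bᵀ = r • M'` for `2 × 2` matrices `B`, `M` and `M'`, given by rows. -/
def Congruent (r k l m n a b a' b' x y x' y' : F) : Prop :=
  r * x = (k * a + l * a') * k + (k * b + l * b') * l ∧
  r * y = (k * a + l * a') * m + (k * b + l * b') * n ∧
  r * x' = (m * a + n * a') * k + (m * b + n * b') * l ∧
  r * y' = (m * a + n * a') * m + (m * b + n * b') * n

/-- Keeping the corner equal to `1` requires `c = det B`, so the block is rescaled only by squares;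
hence `ν` appears in the list. -/
theorem similar_of_unit_corner {k l m n a b a' b' x y x' y' : F} (hd : k * n - l * m ≠ 0)
    (h : Congruent ((k * n - l * m) ^ 2) k l m n a b a' b' x y x' y') :
    Similar !![1, 0, 0; 0, a, b; 0, a', b'] !![1, 0, 0; 0, x, y; 0, x', y'] := by
  obtain ⟨h1, h2, h3, h4⟩ := h
  refine similar_of_eq (k * n - l * m) 0 0 0 0 k l m n hd hd ?_ ?_ ?_ ?_ ?_ ?_ ?_ ?_ ?_
  · ring
  · ring
  · ring
  · ring
  · linear_combination h1
  · linear_combination h2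
  · ring
  · linear_combination h3
  · linear_combination h4

theorem similar_clear_column {α γ₁ γ₂ a b a' b' : F} (hα : α ≠ 0) :
    Similar !![α, 0, 0; γ₁, a, b; γ₂, a', b']
      !![1, 0, 0; 0, α * a, α * b; 0, α * a', α * b'] := by
  refine similar_of_eq α⁻¹ (-γ₁ / α) (-γ₂ / α) 0 0 1 0 0 1 (inv_ne_zero hα) (by simp)
    ?_ ?_ ?_ ?_ ?_ ?_ ?_ ?_ ?_ <;> field_simp <;> ring

theorem similar_of_zero_row (c e₁ e₂ : F) {k l m n γ₁ γ₂ a b a' b' γ₁' γ₂' x y x' y' : F}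
    (hc : c ≠ 0) (hd : k * n - l * m ≠ 0)
    (h : Congruent (c * (k * n - l * m)) k l m n a b a' b' x y x' y')
    (h1 : c * (k * n - l * m) * γ₁' = c * (k * γ₁ + l * γ₂) + (k * a + l * a') * e₁ +
      (k * b + l * b') * e₂)
    (h2 : c * (k * n - l * m) * γ₂' = c * (m * γ₁ + n * γ₂) + (m * a + n * a') * e₁ +
      (m * b + n * b') * e₂) :
    Similar !![0, 0, 0; γ₁, a, b; γ₂, a', b'] !![0, 0, 0; γ₁', x, y; γ₂', x', y'] := by
  obtain ⟨h3, h4, h5, h6⟩ := h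
  refine similar_of_eq c 0 0 e₁ e₂ k l m n hc hd ?_ ?_ ?_ ?_ ?_ ?_ ?_ ?_ ?_
  · ring
  · ring
  · ring
  · linear_combination h1
  · linear_combination h3
  · linear_combination h4
  · linear_combination h2
  · linear_combination h5
  · linear_combination h6

theorem similar_of_zero_row_congruent {k l m n γ₁ γ₂ a b a' b' x y x' y' : F}
    (hd : k * n - l * m = 1) (h : Congruent 1 k l m n a b a' b' x y x' y') :
    Similar !![0, 0, 0; γ₁, a, b; γ₂, a', b']
      !![0, 0, 0; k * γ₁ + l * γ₂, x, y; m * γ₁ + n * γ₂, x', y'] :=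
  similar_of_zero_row (k := k) (l := l) (m := m) (n := n) 1 0 0 one_ne_zero (by simp [hd])
    (by simpa [hd] using h)
    (by rw [hd]; ring) (by rw [hd]; ring)

/-- If the lower right block is invertible, then the column to its left can be cleared. -/
theorem similar_of_det_ne_zero (c : F) {k l m n γ₁ γ₂ a b a' b' x y x' y' : F}
    (hc : c ≠ 0) (hd : k * n - l * m ≠ 0) (hM : a * b' - b * a' ≠ 0)
    (h : Congruent (c * (k * n - l * m)) k l m n a b a' b' x y x' y') :
    Similar !![0, 0, 0; γ₁, a, b; γ₂, a', b'] !![0, 0, 0; 0, x, y; 0, x', y'] := by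
  obtain ⟨t, ht⟩ : ∃ t, (a * b' - b * a') * t = 1 := ⟨_, mul_inv_cancel₀ hM⟩
  -- Cramer's rule for `M * e = -c • γ`.
  refine similar_of_zero_row c (-c * (b' * γ₁ - b * γ₂) * t) (-c * (-a' * γ₁ + a * γ₂) * t) hc hd h
    ?_ ?_
  · linear_combination c * (k * γ₁ + l * γ₂) * ht
  · linear_combination c * (m * γ₁ + n * γ₂) * ht

/-- The vector `(k, l) = (w 0 2, -w 0 1)` annihilates the first row, and the value of that row on
`(m, n)` is then the determinant, so the new entries are `0` and `1`. The unit entry next clears the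
rest of its row (by `e₂`) and its column (by `d₁`, `d₂`). -/
theorem similar_of_row {w : Matrix (Fin 3) (Fin 3) F} (hw : w 0 1 ≠ 0 ∨ w 0 2 ≠ 0) :
    ∃ g₁ g₂ m₁ m₂ : F, Similar w !![0, 0, 1; g₁, m₁, 0; g₂, m₂, 0] := by
  obtain ⟨m, n, hmn⟩ : ∃ m n, w 0 1 * m + w 0 2 * n ≠ 0 := by
    rcases hw with h | h
    · exact ⟨1, 0, by simpa⟩
    · exact ⟨0, 1, by simpa⟩
  have hd : w 0 2 * n - -w 0 1 * m ≠ 0 := by convert hmn using 1; ring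
  obtain ⟨w', hw'⟩ : ∃ w', (1 * (w 0 2 * n - -w 0 1 * m)) • w' =
      !![1, 0, 0; 0, w 0 2, -w 0 1; 0, m, n] * w * !![1, 0, 0; 0, w 0 2, m; 0, -w 0 1, n] :=
    ⟨(1 * (w 0 2 * n - -w 0 1 * m))⁻¹ • _, smul_inv_smul₀ (mul_ne_zero one_ne_zero hd) _⟩
  have h : Similar w w' := ⟨1, 0, 0, 0, 0, w 0 2, -w 0 1, m, n, one_ne_zero, hd, hw'⟩
  have h1 : w' 0 1 = 0 := by
    have := congrFun (congrFun hw' 0) 1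
    simp [mul_apply, vecMul, dotProduct, Fin.sum_univ_three] at this
    exact (mul_eq_zero.mp ((by linear_combination this :
      (w 0 2 * n - -w 0 1 * m) * w' 0 1 = 0))).resolve_left hd
  have h2 : w' 0 2 = 1 := by
    have := congrFun (congrFun hw' 0) 2
    simp [mul_apply, vecMul, dotProduct, Fin.sum_univ_three] at this
    exact mul_left_cancel₀ hd (by linear_combination this)
  rw [eta_fin_three w', h1, h2] at h
  exact ⟨_, _, _, _, h.trans (similar_of_eq (γ₁' := w' 1 0 - w' 1 2 * w' 0 0)
    (γ₂' := w' 2 0 - w' 2 2 * w' 0 0)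
    (x := w' 1 1) (x' := w' 2 1) 1 (-w' 1 2) (-w' 2 2) 0 (-w' 0 0) 1 0 0 1 one_ne_zero (by simp)
    (by ring) (by ring) (by ring) (by ring) (by ring) (by ring) (by ring) (by ring) (by ring))⟩

/-- The freedom left by this shape: `k = 1`, `l = 0`, `e₂ = 0`, and the `d`'s restore the zeros of
the last column. `Similar.exists_of_unit_row` shows that there is no more. -/
theorem similar_of_unit_row {g₁ g₂ m₁ m₂ g₁' g₂' m₁' m₂' : F} (c n b e : F) (hc : c ≠ 0)
    (hn : n ≠ 0) (h1 : c * n * m₁' = m₁) (h2 : c * n * m₂' = b * m₁ + n * m₂)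
    (h3 : c * n * g₁' = c * g₁ + m₁ * e)
    (h4 : c * n * g₂' = c * (b * g₁ + n * g₂) + (b * m₁ + n * m₂) * e) :
    Similar !![0, 0, 1; g₁, m₁, 0; g₂, m₂, 0] !![0, 0, 1; g₁', m₁', 0; g₂', m₂', 0] := by
  refine similar_of_eq c (-m₁ * b / n) (-(b * m₁ + n * m₂) * b / n) e 0 1 0 b n hc (by simpa)
    ?_ ?_ ?_ ?_ ?_ ?_ ?_ ?_ ?_
  · ring
  · ring
  · ring
  · linear_combination h3
  · linear_combination h1
  · field_simp; ring
  · linear_combination h4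
  · linear_combination h2
  · field_simp; ring

end Field

section Prime

variable {p : ℕ} [Fact p.Prime]

theorem exists_inList_of_row (η : ZMod p) {w : Matrix (Fin 3) (Fin 3) (ZMod p)}
    (hw : w 0 1 ≠ 0 ∨ w 0 2 ≠ 0) : ∃ w', InList p η w' ∧ Similar w w' := by
  obtain ⟨g₁, g₂, m₁, m₂, h⟩ := similar_of_row hw
  suffices ∃ w', InList p η w' ∧ Similar !![0, 0, 1; g₁, m₁, 0; g₂, m₂, 0] w' by
    obtain ⟨w', hl, h'⟩ := this
    exact ⟨w', hl, h.trans h'⟩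
  by_cases hm₁ : m₁ = 0
  · subst hm₁
    by_cases hm₂ : m₂ = 0
    · subst hm₂
      by_cases hg₁ : g₁ = 0
      · subst hg₁
        have hs := similar_of_unit_row (g₁ := 0) (g₁' := 0) (g₂ := g₂) (g₂' := g₂) (m₁ := 0)
          (m₁' := 0) (m₂ := 0) (m₂' := 0) 1 1 0 0 one_ne_zero one_ne_zero (by ring) (by ring)
          (by ring) (by ring)
        by_cases hg₂ : g₂ = 0
        · subst hg₂
          exact ⟨_, .F6, hs⟩
        · exact ⟨_, .E15 g₂ hg₂, hs⟩
      · exact ⟨_, .E14, similar_of_unit_row 1 g₁ (-g₂) 0 one_ne_zero hg₁ (by ring) (by ring)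
          (by ring) (by ring)⟩
    · by_cases hg₁ : g₁ = 0
      · subst hg₁
        exact ⟨_, .E13, similar_of_unit_row m₂ 1 0 (-g₂) hm₂ one_ne_zero (by ring) (by ring)
          (by ring) (by ring)⟩
      · exact ⟨_, .D9, similar_of_unit_row m₂ g₁ 0 (-g₂) hm₂ hg₁ (by ring) (by ring)
          (by ring) (by ring)⟩
  -- A nonzero `m₁` clears `m₂` and `g₁`; the remaining entry `t` cannot be rescaled.
  · obtain ⟨t, ht⟩ : ∃ t, Similar !![0, 0, 1; g₁, m₁, 0; g₂, m₂, 0] !![0, 0, 1; 0, 1, 0; t, 0, 0] :=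
      ⟨(-m₂ / m₁) * g₁ + g₂, similar_of_unit_row m₁ 1 (-m₂ / m₁) (-g₁) hm₁ one_ne_zero (by ring)
        (by field_simp; ring) (by ring) (by field_simp; ring)⟩
    by_cases h0 : t = 0
    · subst h0
      exact ⟨_, .E12, ht⟩
    · exact ⟨_, .D8 t h0, ht⟩

/-- A binary form that represents `s ≠ 0`, in normal form. -/
theorem exists_congruent_of_value (hp : p ≠ 2) {a b a' b' k l s : ZMod p} (hs : s ≠ 0)
    (h : (k * a + l * a') * k + (k * b + l * b') * l = s) :
    ∃ m n t r, k * n - l * m = 1 ∧ Congruent 1 k l m n a b a' b' s t (-t) r := by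
  have h2 : (2 : ZMod p) ≠ 0 := Ring.two_ne_zero (by rwa [ZMod.ringChar_zmod_n])
  obtain ⟨m, n, hmn⟩ : ∃ m n, k * n - l * m = 1 := by
    by_cases hk : k = 0
    · have hl : l ≠ 0 := by
        rintro rfl
        simp [hk] at h
        exact hs h.symm
      exact ⟨-l⁻¹, 0, by field_simp; ring⟩
    · exact ⟨0, k⁻¹, by field_simp; ring⟩
  -- Adding `x` times `(k, l)` to `(m, n)` makes the second vector orthogonal to the first for the
  -- symmetric part, so the off-diagonal entries become opposite.
  obtain ⟨x, hx⟩ : ∃ x, 2 * s * x = -((k * a + l * a') * m + (k * b + l * b') * n +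
      ((m * a + n * a') * k + (m * b + n * b') * l)) :=
    ⟨_ / (2 * s), mul_div_cancel₀ _ (mul_ne_zero h2 hs)⟩
  refine ⟨m + x * k, n + x * l, (k * a + l * a') * (m + x * k) + (k * b + l * b') * (n + x * l), _,
    by linear_combination hmn, by linear_combination -h, by ring, ?_, one_mul _⟩
  linear_combination -hx - 2 * x * h

theorem exists_sq_mul_add_sq_mul (hp : p ≠ 2) {s r : ZMod p} (hs : s ≠ 0) (hr : r ≠ 0) :
    ∃ x y, s * x ^ 2 + r * y ^ 2 = 1 := by
  open Polynomial in
  obtain ⟨x, y, h⟩ := FiniteField.exists_root_sum_quadratic (R := ZMod p)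
    (f := C s * X ^ 2 + C 0 * X + C (-1)) (g := C r * X ^ 2 + C 0 * X + C 0)
    (degree_quadratic hs) (degree_quadratic hr)
    (by rw [ZMod.card]; exact (Fact.out : p.Prime).eq_two_or_odd.resolve_left hp)
  refine ⟨x, y, ?_⟩
  simp at h
  linear_combination h

/-- The cases are: the quadratic form takes the value `1`; it takes nonzero values but not `1`; it
is zero. In the second case it must be degenerate, since a nondegenerate binary form over `F_p`
represents `1`. -/
theorem exists_congruent (hp : p ≠ 2) (a b a' b' : ZMod p) :
    ∃ k l m n s t r, k * n - l * m = 1 ∧ Congruent 1 k l m n a b a' b' s t (-t) r ∧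
      (s = 0 ∧ r = 0 ∨ s ≠ 0 ∧ r = 0 ∨ s = 1 ∧ r ≠ 0) := by
  by_cases h1 : ∃ k l, (k * a + l * a') * k + (k * b + l * b') * l = 1
  · obtain ⟨k, l, h⟩ := h1
    obtain ⟨m, n, t, r, hd, hc⟩ := exists_congruent_of_value hp one_ne_zero h
    refine ⟨k, l, m, n, 1, t, r, hd, hc, ?_⟩
    by_cases hr : r = 0 <;> simp [hr]
  by_cases h2 : ∃ k l, (k * a + l * a') * k + (k * b + l * b') * l ≠ 0
  · obtain ⟨k, l, h⟩ := h2
    obtain ⟨m, n, t, r, hd, hc⟩ := exists_congruent_of_value hp h rfl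
    refine ⟨k, l, m, n, _, t, r, hd, hc, .inr (.inl ⟨h, ?_⟩)⟩
    by_contra hr
    obtain ⟨x, y, hxy⟩ := exists_sq_mul_add_sq_mul hp h hr
    refine h1 ⟨x * k + y * m, x * l + y * n, ?_⟩
    obtain ⟨-, hc2, hc3, hc4⟩ := hc
    linear_combination hxy - x * y * hc2 - x * y * hc3 - y ^ 2 * hc4
  · push Not at h2
    have e1 := h2 1 0
    have e2 := h2 0 1
    have e3 := h2 1 1
    refine ⟨1, 0, 0, 1, 0, b, 0, by ring, ⟨?_, ?_, ?_, ?_⟩, .inl ⟨rfl, rfl⟩⟩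
    · linear_combination -e1
    · ring
    · linear_combination -e3 + e1 + e2
    · linear_combination -e2

theorem exists_eq_mul_sq {η : ZMod p} (hη : ¬ IsSquare η) {s : ZMod p} (hs : s ≠ 0) :
    ∃ ν t, (ν = 1 ∨ ν = η) ∧ t ≠ 0 ∧ s * t ^ 2 = ν := by
  by_cases h : IsSquare s
  · obtain ⟨t, rfl⟩ := h
    have ht : t ≠ 0 := left_ne_zero_of_mul hs
    exact ⟨1, t⁻¹, .inl rfl, inv_ne_zero ht, by field_simp⟩
  · have hη0 : η ≠ 0 := by
      rintro rfl
      exact hη (IsSquare.zero)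
    have hsη : IsSquare (s * η) := by
      rw [← quadraticChar_one_iff_isSquare (mul_ne_zero hs hη0), map_mul,
        quadraticChar_neg_one_iff_not_isSquare.mpr h, quadraticChar_neg_one_iff_not_isSquare.mpr hη]
      rfl
    obtain ⟨t, ht⟩ := hsη
    have ht0 : t ≠ 0 := by
      rintro rfl
      exact mul_ne_zero hs hη0 (by simpa using ht)
    exact ⟨η, t / s, .inr rfl, div_ne_zero ht0 hs, by field_simp; linear_combination -ht⟩

end Prime
end CharMat

/-! ### Reduction of every matrix to the list -/

namespace CharMat
open Matrix

section Field

variable {F : Type*} [Field F]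

theorem similar_of_unit_corner_congruent {k l m n a b a' b' x y x' y' : F} (hd : k * n - l * m = 1)
    (h : Congruent 1 k l m n a b a' b' x y x' y') :
    Similar !![1, 0, 0; 0, a, b; 0, a', b'] !![1, 0, 0; 0, x, y; 0, x', y'] :=
  similar_of_unit_corner (k := k) (l := l) (m := m) (n := n) (by simp [hd]) (by simpa [hd] using h)

theorem similar_unit_corner_swap {s q ν : F} (hq : q ≠ 0) (h : s * q ^ 2 = ν) :
    Similar !![1, 0, 0; 0, s, 0; 0, 0, 0] !![1, 0, 0; 0, 0, 0; 0, 0, ν] := by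
  subst h
  refine similar_of_unit_corner (k := 0) (l := q⁻¹) (m := 1) (n := 0) (by simpa)
    ⟨?_, ?_, ?_, ?_⟩ <;> field_simp <;> ring

/-- The block factors as the column `(1, -1)` times the row `(1, 1)`, which the base change sends to
`2` times the first and second unit vector. Thus `r = -1` gives no new block. -/
theorem congruent_skew : Congruent (4 : F) 1 (-1) 1 1 1 1 (-1) (-1) 0 1 0 0 := by
  refine ⟨?_, ?_, ?_, ?_⟩ <;> ring

end Field

section Prime

variable {p : ℕ} [Fact p.Prime] (η : ZMod p)

theorem exists_inList_of_zero_block (γ₁ γ₂ : ZMod p) :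
    ∃ w', InList p η w' ∧ Similar !![0, 0, 0; γ₁, 0, 0; γ₂, 0, 0] w' := by
  by_cases h : γ₁ = 0 ∧ γ₂ = 0
  · obtain ⟨rfl, rfl⟩ := h
    exact ⟨_, .F5, similar_of_zero_row 1 0 0 (k := 1) (l := 0) (m := 0) (n := 1) one_ne_zero
      (by simp) ⟨by ring, by ring, by ring, by ring⟩ (by ring) (by ring)⟩
  · obtain ⟨k, l, hkl⟩ : ∃ k l, k * γ₁ - l * -γ₂ ≠ 0 := by
      rcases not_and_or.mp h with h | h
      · exact ⟨1, 0, by simpa⟩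
      · exact ⟨0, 1, by simpa⟩
    exact ⟨_, .F4, similar_of_zero_row 1 0 0 (k := k) (l := l) (m := -γ₂) (n := γ₁) one_ne_zero hkl
      ⟨by ring, by ring, by ring, by ring⟩ (by ring) (by ring)⟩

/-- The left column matters only modulo the column space of the block, here the first coordinate
axis; so only whether `γ₂` vanishes counts. -/
theorem exists_inList_of_nilpotent_block (γ₁ γ₂ : ZMod p) :
    ∃ w', InList p η w' ∧ Similar !![0, 0, 0; γ₁, 0, 1; γ₂, 0, 0] w' := by
  by_cases h : γ₂ = 0
  · subst h
    exact ⟨_, .F2, similar_of_zero_row 1 0 (-γ₁) (k := 1) (l := 0) (m := 0) (n := 1) one_ne_zero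
      (by simp) ⟨by ring, by ring, by ring, by ring⟩ (by ring) (by ring)⟩
  · exact ⟨_, .E10, similar_of_zero_row 1 0 (-γ₁) (k := γ₂) (l := 0) (m := 0) (n := 1) one_ne_zero
      (by simpa) ⟨by ring, by ring, by ring, by ring⟩ (by ring) (by ring)⟩

theorem exists_inList_of_symmetric_block (γ₁ γ₂ : ZMod p) {s : ZMod p} (hs : s ≠ 0) :
    ∃ w', InList p η w' ∧ Similar !![0, 0, 0; γ₁, s, 0; γ₂, 0, 0] w' := by
  by_cases h : γ₂ = 0
  · subst h
    exact ⟨_, .F3, similar_of_zero_row (-s) γ₁ 0 (k := 0) (l := 1) (m := 1) (n := 0)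
      (neg_ne_zero.mpr hs) (by simp) ⟨by ring, by ring, by ring, by ring⟩ (by ring) (by ring)⟩
  · exact ⟨_, .E11, similar_of_zero_row (γ₂ * s) (-γ₂ * γ₁) 0 (k := 0) (l := 1) (m := -γ₂) (n := 0)
      (mul_ne_zero h hs) (by simpa) ⟨by ring, by ring, by ring, by ring⟩ (by ring) (by ring)⟩

theorem eq_neg_one_or_exists_nat {r : ZMod p} (hr : r ≠ 0) :
    r = -1 ∨ ∃ n : ℕ, 1 ≤ n ∧ n ≤ p - 2 ∧ r = n := by
  have hlt := ZMod.val_lt r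
  have hpos : r.val ≠ 0 := by rwa [Ne, ZMod.val_eq_zero]
  by_cases h : r.val = p - 1
  · left
    rw [← ZMod.natCast_zmod_val r, h, Nat.cast_sub (Fact.out : p.Prime).one_le]
    simp
  · right
    exact ⟨r.val, by omega, by omega, (ZMod.natCast_zmod_val r).symm⟩

variable {η}

theorem exists_inList_of_unit_corner (hp : p ≠ 2) (hη : ¬ IsSquare η) (a b a' b' : ZMod p) :
    ∃ w', InList p η w' ∧ Similar !![1, 0, 0; 0, a, b; 0, a', b'] w' := by
  have h2 : (2 : ZMod p) ≠ 0 := Ring.two_ne_zero (by rwa [ZMod.ringChar_zmod_n])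
  obtain ⟨k, l, m, n, s, t, r, hd, hc, hsr⟩ := exists_congruent hp a b a' b'
  suffices ∃ w', InList p η w' ∧ Similar !![1, 0, 0; 0, s, t; 0, -t, r] w' by
    obtain ⟨w', hl, h'⟩ := this
    exact ⟨w', hl, (similar_of_unit_corner_congruent hd hc).trans h'⟩
  by_cases ht : t = 0
  · subst ht
    rw [neg_zero]
    rcases hsr with ⟨rfl, rfl⟩ | ⟨hs, rfl⟩ | ⟨rfl, hr⟩
    · exact ⟨_, .F1, similar_of_unit_corner_congruent (k := 1) (l := 0) (m := 0) (n := 1) (by ring)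
        ⟨by ring, by ring, by ring, by ring⟩⟩
    · obtain ⟨ν, q, hν, hq, h⟩ := exists_eq_mul_sq hη hs
      exact ⟨_, .E9 ν (hν.imp_right fun h => ⟨hp, h⟩), similar_unit_corner_swap hq h⟩
    · obtain ⟨_, q, hν, hq, rfl⟩ := exists_eq_mul_sq hη hr
      refine ⟨_, .D3 hp _ hν, similar_of_unit_corner (k := q⁻¹) (l := 0) (m := 0) (n := 1)
        (by simpa) ⟨?_, ?_, ?_, ?_⟩⟩ <;> field_simp <;> ring
  · rcases hsr with ⟨rfl, rfl⟩ | ⟨hs, rfl⟩ | ⟨rfl, hr⟩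
    · exact ⟨_, .D1 hp, similar_of_unit_corner (k := 1) (l := 0) (m := 0) (n := t)
        (by simpa) ⟨by ring, by ring, by ring, by ring⟩⟩
    · obtain ⟨_, q, hν, hq, rfl⟩ := exists_eq_mul_sq hη hs
      -- Determinant `t` normalises the skew entry to `1`, and the free factor `q` moves `s` within
      -- its square class.
      refine ⟨_, .D2 hp _ hν, similar_of_unit_corner (k := t * q) (l := 0) (m := 0) (n := q⁻¹)
        (by simp [ht, hq]) ⟨?_, ?_, ?_, ?_⟩⟩ <;> field_simp <;> ring
    · have h1 : Similar !![1, 0, 0; 0, 1, t; 0, -t, r] !![1, 0, 0; 0, 1, 1; 0, -1, r / t ^ 2] := by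
        refine similar_of_unit_corner (k := t) (l := 0) (m := 0) (n := 1)
          (by simpa) ⟨?_, ?_, ?_, ?_⟩ <;> field_simp <;> ring
      rcases eq_neg_one_or_exists_nat (div_ne_zero hr (pow_ne_zero 2 ht)) with h | ⟨n, hn, hn', h⟩
      · rw [h] at h1
        have hd : (1 : ZMod p) * 1 - -1 * 1 = 2 := by norm_num
        refine ⟨_, .E8, h1.trans (similar_of_unit_corner (by rwa [hd]) (n := 1) ?_)⟩
        rw [hd]
        convert congruent_skew using 1
        norm_num
      · rw [h] at h1
        exact ⟨_, .D4 hp n hn hn', h1⟩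

theorem exists_inList_of_zero_row (hp : p ≠ 2) (hη : ¬ IsSquare η) (γ₁ γ₂ a b a' b' : ZMod p) :
    ∃ w', InList p η w' ∧ Similar !![0, 0, 0; γ₁, a, b; γ₂, a', b'] w' := by
  have h2 : (2 : ZMod p) ≠ 0 := Ring.two_ne_zero (by rwa [ZMod.ringChar_zmod_n])
  obtain ⟨k, l, m, n, s, t, r, hd, hc, hsr⟩ := exists_congruent hp a b a' b'
  suffices ∀ γ₁ γ₂, ∃ w', InList p η w' ∧ Similar !![0, 0, 0; γ₁, s, t; γ₂, -t, r] w' by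
    obtain ⟨w', hl, h'⟩ := this _ _
    exact ⟨w', hl, (similar_of_zero_row_congruent hd hc).trans h'⟩
  clear hc hd γ₁ γ₂ a b a' b'
  intro γ₁ γ₂
  by_cases ht : t = 0
  · subst ht
    rw [neg_zero]
    rcases hsr with ⟨rfl, rfl⟩ | ⟨hs, rfl⟩ | ⟨rfl, hr⟩
    · exact exists_inList_of_zero_block η γ₁ γ₂
    · exact exists_inList_of_symmetric_block η γ₁ γ₂ hs
    · obtain ⟨_, q, hν, hq, rfl⟩ := exists_eq_mul_sq hη hr
      refine ⟨_, .E3 hp _ hν, similar_of_det_ne_zero q⁻¹ (k := 1) (l := 0) (m := 0) (n := q)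
        (by simpa) (by simpa) (by simpa) ⟨?_, ?_, ?_, ?_⟩⟩ <;> field_simp <;> ring
  · rcases hsr with ⟨rfl, rfl⟩ | ⟨hs, rfl⟩ | ⟨rfl, hr⟩
    · exact ⟨_, .E1 hp, similar_of_det_ne_zero t (k := 1) (l := 0) (m := 0) (n := 1)
        ht (by simp) (by simpa) ⟨by ring, by ring, by ring, by ring⟩⟩
    · refine ⟨_, .E2 hp, similar_of_det_ne_zero t (k := 1) (l := 0) (m := 0) (n := s / t)
        ht (by simp [hs, ht]) (by simpa) ⟨?_, ?_, ?_, ?_⟩⟩ <;> field_simp <;> ring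
    · have h1 : Similar !![0, 0, 0; γ₁, 1, t; γ₂, -t, r]
          !![0, 0, 0; t * γ₁, 1, 1; γ₂, -1, r / t ^ 2] := by
        refine similar_of_zero_row t 0 0 (k := 1) (l := 0) (m := 0) (n := t⁻¹)
          ht (by simpa) ⟨?_, ?_, ?_, ?_⟩ ?_ ?_ <;> field_simp <;> ring
      -- Exactly for this ratio the block is singular, so the left column can no longer be cleared
      -- entirely.
      by_cases h : r / t ^ 2 = -1
      · rw [h] at h1
        obtain ⟨w', hl, h'⟩ := exists_inList_of_nilpotent_block η
          ((t * γ₁ - γ₂) / 2) ((t * γ₁ + γ₂) / 2)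
        refine ⟨w', hl, h1.trans (Similar.trans (similar_of_zero_row 2 0 0 (k := 1) (l := -1)
          (m := 1) (n := 1) h2 (by norm_num; exact h2) ?_ ?_ ?_) h')⟩
        · convert congruent_skew using 1
          norm_num
        · field_simp
          ring
        · field_simp
          ring
      · obtain ⟨n, hn, hn', hrn⟩ :=
          (eq_neg_one_or_exists_nat (div_ne_zero hr (pow_ne_zero 2 ht))).resolve_left h
        rw [hrn] at h1 h
        exact ⟨_, .E4 hp n hn hn', h1.trans (similar_of_det_ne_zero 1 (k := 1) (l := 0) (m := 0)
          (n := 1) one_ne_zero (by simp) (fun h0 => h (by linear_combination h0))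
          ⟨by ring, by ring, by ring, by ring⟩)⟩

end Prime

/-- In characteristic two there is no splitting into symmetric and skew parts; the sixteen blocks
are checked directly, and `1` is the only nonzero scalar. -/
theorem exists_congruent_two (a b a' b' : ZMod 2) : ∃ k l m n : ZMod 2, k * n - l * m = 1 ∧
    (Congruent 1 k l m n a b a' b' 0 1 1 0 ∨ Congruent 1 k l m n a b a' b' 1 0 0 1 ∨
      Congruent 1 k l m n a b a' b' 1 0 1 1 ∨ Congruent 1 k l m n a b a' b' 0 1 0 0 ∨
      Congruent 1 k l m n a b a' b' 1 0 0 0 ∨ Congruent 1 k l m n a b a' b' 0 0 0 0) := by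
  unfold Congruent
  decide +revert

theorem exists_inList_of_unit_corner_two (η a b a' b' : ZMod 2) :
    ∃ w', InList 2 η w' ∧ Similar !![1, 0, 0; 0, a, b; 0, a', b'] w' := by
  obtain ⟨k, l, m, n, hd, h | h | h | h | h | h⟩ := exists_congruent_two a b a' b'
  · exact ⟨_, .D5 rfl, similar_of_unit_corner_congruent hd h⟩
  · exact ⟨_, .D6 rfl, similar_of_unit_corner_congruent hd h⟩
  · exact ⟨_, .D7 rfl, similar_of_unit_corner_congruent hd h⟩
  · exact ⟨_, .E8, similar_of_unit_corner_congruent hd h⟩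
  · exact ⟨_, .E9 1 (.inl rfl), (similar_of_unit_corner_congruent hd h).trans
      (similar_unit_corner_swap one_ne_zero (by norm_num))⟩
  · exact ⟨_, .F1, similar_of_unit_corner_congruent hd h⟩

theorem exists_inList_of_zero_row_two (η γ₁ γ₂ a b a' b' : ZMod 2) :
    ∃ w', InList 2 η w' ∧ Similar !![0, 0, 0; γ₁, a, b; γ₂, a', b'] w' := by
  have clear : ∀ {γ₁ γ₂ a b a' b' : ZMod 2}, a * b' - b * a' ≠ 0 →
      Similar !![0, 0, 0; γ₁, a, b; γ₂, a', b'] !![0, 0, 0; 0, a, b; 0, a', b'] := fun h =>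
    similar_of_det_ne_zero 1 (k := 1) (l := 0) (m := 0) (n := 1) one_ne_zero (by simp) h
      ⟨by ring, by ring, by ring, by ring⟩
  obtain ⟨k, l, m, n, hd, h⟩ := exists_congruent_two a b a' b'
  have lift : ∀ {x y x' y'}, Congruent 1 k l m n a b a' b' x y x' y' →
      (∀ γ₁ γ₂, ∃ w', InList 2 η w' ∧ Similar !![0, 0, 0; γ₁, x, y; γ₂, x', y'] w') →
      ∃ w', InList 2 η w' ∧ Similar !![0, 0, 0; γ₁, a, b; γ₂, a', b'] w' := by
    intro x y x' y' h H
    obtain ⟨w', hl, h'⟩ := H _ _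
    exact ⟨w', hl, (similar_of_zero_row_congruent hd h).trans h'⟩
  rcases h with h | h | h | h | h | h
  · exact lift h fun _ _ => ⟨_, .E5 rfl, clear (by decide)⟩
  · exact lift h fun _ _ => ⟨_, .E6 rfl, clear (by decide)⟩
  · exact lift h fun _ _ => ⟨_, .E7 rfl, clear (by decide)⟩
  · exact lift h (exists_inList_of_nilpotent_block η)
  · exact lift h fun _ _ => exists_inList_of_symmetric_block η _ _ one_ne_zero
  · exact lift h (exists_inList_of_zero_block η)

theorem exists_inList {p : ℕ} [Fact p.Prime] {η : ZMod p} (hη : p ≠ 2 → ¬ IsSquare η)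
    (w : Matrix (Fin 3) (Fin 3) (ZMod p)) : ∃ w', InList p η w' ∧ Similar w w' := by
  by_cases hw : w 0 1 = 0 ∧ w 0 2 = 0
  · rw [eta_fin_three w, hw.1, hw.2]
    by_cases h0 : w 0 0 = 0
    · rw [h0]
      by_cases hp : p = 2
      · subst hp
        exact exists_inList_of_zero_row_two _ _ _ _ _ _ _
      · exact exists_inList_of_zero_row hp (hη hp) _ _ _ _ _ _
    · suffices ∀ a b a' b', ∃ w', InList p η w' ∧ Similar !![1, 0, 0; 0, a, b; 0, a', b'] w' by
        obtain ⟨w', hl, h'⟩ := this _ _ _ _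
        exact ⟨w', hl, (similar_clear_column h0).trans h'⟩
      by_cases hp : p = 2
      · subst hp
        exact exists_inList_of_unit_corner_two _
      · exact exists_inList_of_unit_corner hp (hη hp)
  · exact exists_inList_of_row η (not_and_or.mp hw)

end CharMat

/-! ### Different matrices of the list are not similar -/

namespace CharMat
open Matrix

section Field

variable {F : Type*} [Field F]

/-- Up to a nonzero scalar, these two entries are multiplied by an invertible `2 × 2` matrix. -/
theorem Similar.row_eq_zero_iff {w w' : Matrix (Fin 3) (Fin 3) F} (h : Similar w w') :
    (w' 0 1 = 0 ∧ w' 0 2 = 0) ↔ (w 0 1 = 0 ∧ w 0 2 = 0) := by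
  obtain ⟨c, d₁, d₂, e₁, e₂, k, l, m, n, hc, hd, h⟩ := h
  have h1 := congrFun (congrFun h 0) 1
  have h2 := congrFun (congrFun h 0) 2
  simp [mul_apply, vecMul, dotProduct, Fin.sum_univ_three] at h1 h2
  constructor
  · rintro ⟨h3, h4⟩
    rw [h3] at h1
    rw [h4] at h2
    have hcd := mul_ne_zero hc hd
    constructor
    · exact (mul_eq_zero.mp ((by linear_combination -n * h1 + l * h2 :
        (c * (k * n - l * m)) * w 0 1 = 0))).resolve_left hcd
    · exact (mul_eq_zero.mp ((by linear_combination m * h1 - k * h2 :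
        (c * (k * n - l * m)) * w 0 2 = 0))).resolve_left hcd
  · rintro ⟨h3, h4⟩
    simpa [h3, h4, hc, hd] using And.intro h1 h2

theorem Similar.exists_of_unit_row {g₁ g₂ m₁ m₂ g₁' g₂' m₁' m₂' : F}
    (h : Similar !![0, 0, 1; g₁, m₁, 0; g₂, m₂, 0] !![0, 0, 1; g₁', m₁', 0; g₂', m₂', 0]) :
    ∃ c n b e, c ≠ 0 ∧ n ≠ 0 ∧ c * n * m₁' = m₁ ∧ c * n * m₂' = b * m₁ + n * m₂ ∧
      c * n * g₁' = c * g₁ + m₁ * e ∧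
      c * n * g₂' = c * (b * g₁ + n * g₂) + (b * m₁ + n * m₂) * e := by
  obtain ⟨c, d₁, d₂, e₁, e₂, k, l, m, n, hc, hd, h⟩ := h
  have h' := fun i j => congrFun (congrFun h i) j
  have h00 := h' 0 0
  have h01 := h' 0 1
  have h02 := h' 0 2
  have h10 := h' 1 0
  have h11 := h' 1 1
  have h20 := h' 2 0
  have h21 := h' 2 1
  simp [hc] at h00 h01 h02 h10 h11 h20 h21
  subst h00 h01
  have hn : n ≠ 0 := by rintro rfl; simp at hd
  have hk : k = 1 := by
    refine mul_right_cancel₀ hn ?_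
    linear_combination h02
  subst hk
  refine ⟨c, n, m, e₁, hc, hn, ?_, ?_, ?_, ?_⟩
  · linear_combination h11
  · linear_combination h21
  · linear_combination h10
  · linear_combination h20

theorem Similar.exists_of_unit_corner {a b a' b' x y x' y' : F}
    (h : Similar !![1, 0, 0; 0, a, b; 0, a', b'] !![1, 0, 0; 0, x, y; 0, x', y']) :
    ∃ k l m n, k * n - l * m ≠ 0 ∧
      Congruent ((k * n - l * m) * (k * n - l * m)) k l m n a b a' b' x y x' y' := by
  obtain ⟨c, d₁, d₂, e₁, e₂, k, l, m, n, hc, hd, h⟩ := h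
  have h' := fun i j => congrFun (congrFun h i) j
  have h00 := h' 0 0
  have h11 := h' 1 1
  have h12 := h' 1 2
  have h21 := h' 2 1
  have h22 := h' 2 2
  simp [hc] at h00 h11 h12 h21 h22
  rw [← h00] at h11 h12 h21 h22
  exact ⟨k, l, m, n, hd, h11, h12, h21, h22⟩

theorem Similar.exists_of_zero_row {γ₁ γ₂ a b a' b' γ₁' γ₂' x y x' y' : F}
    (h : Similar !![0, 0, 0; γ₁, a, b; γ₂, a', b'] !![0, 0, 0; γ₁', x, y; γ₂', x', y']) :
    ∃ c e₁ e₂ k l m n, c ≠ 0 ∧ k * n - l * m ≠ 0 ∧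
      Congruent (c * (k * n - l * m)) k l m n a b a' b' x y x' y' ∧
      c * (k * n - l * m) * γ₁' = c * (k * γ₁ + l * γ₂) + (k * a + l * a') * e₁ +
        (k * b + l * b') * e₂ ∧
      c * (k * n - l * m) * γ₂' = c * (m * γ₁ + n * γ₂) + (m * a + n * a') * e₁ +
        (m * b + n * b') * e₂ := by
  obtain ⟨c, d₁, d₂, e₁, e₂, k, l, m, n, hc, hd, h⟩ := h
  have h' := fun i j => congrFun (congrFun h i) j
  have h10 := h' 1 0
  have h20 := h' 2 0
  have h11 := h' 1 1
  have h12 := h' 1 2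
  have h21 := h' 2 1
  have h22 := h' 2 2
  simp at h10 h20 h11 h12 h21 h22
  exact ⟨c, e₁, e₂, k, l, m, n, hc, hd, ⟨h11, h12, h21, h22⟩, by linear_combination h10,
    by linear_combination h20⟩

theorem not_similar_unit_corner_zero_row {a b a' b' γ₁ γ₂ x y x' y' : F} :
    ¬ Similar !![1, 0, 0; 0, a, b; 0, a', b'] !![0, 0, 0; γ₁, x, y; γ₂, x', y'] := by
  rintro ⟨c, d₁, d₂, e₁, e₂, k, l, m, n, hc, hd, h⟩
  have h00 := congrFun (congrFun h 0) 0
  simp [hc] at h00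

theorem not_similar_zero_row_unit_corner {a b a' b' γ₁ γ₂ x y x' y' : F} :
    ¬ Similar !![0, 0, 0; γ₁, x, y; γ₂, x', y'] !![1, 0, 0; 0, a, b; 0, a', b'] := by
  rintro ⟨c, d₁, d₂, e₁, e₂, k, l, m, n, hc, hd, h⟩
  have h00 := congrFun (congrFun h 0) 0
  simp [hc] at h00
  exact hd h00

end Field

section Prime

variable {p : ℕ} [Fact p.Prime]

/-- The lower right blocks in the list, where `V` tells which coefficients occur in the blocks
whose symmetric part has rank one. -/
def IsListBlock (η : ZMod p) (V : ZMod p → Prop) (a b a' b' : ZMod p) : Prop :=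
  p ≠ 2 ∧ (a = 0 ∧ b = 1 ∧ a' = -1 ∧ b' = 0 ∨ V a ∧ b = 1 ∧ a' = -1 ∧ b' = 0 ∨
    a = 1 ∧ b = 0 ∧ a' = 0 ∧ (b' = 1 ∨ b' = η) ∨
    a = 1 ∧ b = 1 ∧ a' = -1 ∧ b' ≠ 0 ∧ b' ≠ -1) ∨
  p = 2 ∧ (a = 0 ∧ b = 1 ∧ a' = 1 ∧ b' = 0 ∨ a = 1 ∧ b = 0 ∧ a' = 0 ∧ b' = 1 ∨
    a = 1 ∧ b = 0 ∧ a' = 1 ∧ b' = 1) ∨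
  a = 0 ∧ b = 1 ∧ a' = 0 ∧ b' = 0 ∨ a = 0 ∧ b = 0 ∧ a' = 0 ∧ V b' ∨
  a = 0 ∧ b = 0 ∧ a' = 0 ∧ b' = 0

theorem eq_of_mul_sq_eq {η : ZMod p} (hη : ¬ IsSquare η) {ν ν' s t : ZMod p}
    (hν : ν = 1 ∨ ν = η) (hν' : ν' = 1 ∨ ν' = η) (hs : s ≠ 0) (ht : t ≠ 0)
    (h : s ^ 2 * ν' = t ^ 2 * ν) : ν = ν' := by
  rcases hν with rfl | rfl <;> rcases hν' with rfl | rfl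
  · rfl
  · exact absurd ⟨t / s, by field_simp; linear_combination h⟩ hη
  · exact absurd ⟨s / t, by field_simp; linear_combination -h⟩ hη
  · rfl

theorem eq_one_of_ne_zero_two : ∀ ν : ZMod 2, ν ≠ 0 → ν = 1 := by
  decide

theorem eq_of_congruent_two {k l m n a b a' b' x y x' y' : ZMod 2} (hd : k * n - l * m ≠ 0)
    (hM : a = 0 ∧ b = 1 ∧ a' = 1 ∧ b' = 0 ∨ a = 1 ∧ b = 0 ∧ a' = 0 ∧ b' = 1 ∨
      a = 1 ∧ b = 0 ∧ a' = 1 ∧ b' = 1 ∨ a = 0 ∧ b = 1 ∧ a' = 0 ∧ b' = 0 ∨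
      a = 0 ∧ b = 0 ∧ a' = 0 ∧ b' = 1 ∨ a = 0 ∧ b = 0 ∧ a' = 0 ∧ b' = 0)
    (hM' : x = 0 ∧ y = 1 ∧ x' = 1 ∧ y' = 0 ∨ x = 1 ∧ y = 0 ∧ x' = 0 ∧ y' = 1 ∨
      x = 1 ∧ y = 0 ∧ x' = 1 ∧ y' = 1 ∨ x = 0 ∧ y = 1 ∧ x' = 0 ∧ y' = 0 ∨
      x = 0 ∧ y = 0 ∧ x' = 0 ∧ y' = 1 ∨ x = 0 ∧ y = 0 ∧ x' = 0 ∧ y' = 0)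
    (h : Congruent 1 k l m n a b a' b' x y x' y') : a = x ∧ b = y ∧ a' = x' ∧ b' = y' := by
  unfold Congruent at h
  rcases hM with ⟨rfl, rfl, rfl, rfl⟩ | ⟨rfl, rfl, rfl, rfl⟩ | ⟨rfl, rfl, rfl, rfl⟩ |
    ⟨rfl, rfl, rfl, rfl⟩ | ⟨rfl, rfl, rfl, rfl⟩ | ⟨rfl, rfl, rfl, rfl⟩ <;>
  rcases hM' with ⟨rfl, rfl, rfl, rfl⟩ | ⟨rfl, rfl, rfl, rfl⟩ | ⟨rfl, rfl, rfl, rfl⟩ |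
    ⟨rfl, rfl, rfl, rfl⟩ | ⟨rfl, rfl, rfl, rfl⟩ | ⟨rfl, rfl, rfl, rfl⟩ <;>
  first
  | exact ⟨rfl, rfl, rfl, rfl⟩
  | (revert h hd; decide +revert)

/-- For odd `p`, the skew part scales by `c` and the determinant by `c ^ 2`; with the congruence
equations this separates the types of blocks and leaves only equality of parameters within a type.
The hypothesis `hV` lets one argument serve both corners: `V` is `{1, η}` (`{1}` for `p = 2`) for
corner `1`, and `{1}` for corner `0`. -/
theorem eq_of_congruent {η : ZMod p} (hη : p ≠ 2 → ¬ IsSquare η) {V : ZMod p → Prop}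
    {c k l m n a b a' b' x y x' y' : ZMod p} (hc : c ≠ 0) (hd : k * n - l * m ≠ 0)
    (hV0 : ¬ V 0) (hV : ∀ ν ν' t, V ν → V ν' → t ≠ 0 →
      c * (k * n - l * m) * ν' = t ^ 2 * ν → ν = ν')
    (hM : IsListBlock η V a b a' b') (hM' : IsListBlock η V x y x' y')
    (h : Congruent (c * (k * n - l * m)) k l m n a b a' b' x y x' y') :
    a = x ∧ b = y ∧ a' = x' ∧ b' = y' := by
  by_cases hp : p = 2
  · subst hp
    have hV1 : ∀ ν, V ν → ν = 1 := fun ν hν => eq_one_of_ne_zero_two ν fun h => hV0 (h ▸ hν)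
    have key : ∀ {a b a' b'}, IsListBlock η V a b a' b' →
        (a = 0 ∧ b = 1 ∧ a' = 1 ∧ b' = 0 ∨ a = 1 ∧ b = 0 ∧ a' = 0 ∧ b' = 1 ∨
        a = 1 ∧ b = 0 ∧ a' = 1 ∧ b' = 1 ∨ a = 0 ∧ b = 1 ∧ a' = 0 ∧ b' = 0 ∨
        a = 0 ∧ b = 0 ∧ a' = 0 ∧ b' = 1 ∨ a = 0 ∧ b = 0 ∧ a' = 0 ∧ b' = 0) := by
      rintro a b a' b' (⟨h, -⟩ | ⟨-, h | h | h⟩ | h | ⟨ha, hb, ha', h⟩ | h)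
      · exact absurd rfl h
      · exact .inl h
      · exact .inr (.inl h)
      · exact .inr (.inr (.inl h))
      · exact .inr (.inr (.inr (.inl h)))
      · exact .inr (.inr (.inr (.inr (.inl ⟨ha, hb, ha', hV1 _ h⟩))))
      · exact .inr (.inr (.inr (.inr (.inr h))))
    rw [eq_one_of_ne_zero_two _ (mul_ne_zero hc hd)] at h
    exact eq_of_congruent_two hd (key hM) (key hM') h
  · have h2 : (2 : ZMod p) ≠ 0 := Ring.two_ne_zero (by rwa [ZMod.ringChar_zmod_n])
    have hη := hη hp
    have hη0 : η ≠ 0 := by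
      rintro rfl
      exact hη (IsSquare.zero)
    have hν0 : ∀ {ν}, ν = 1 ∨ ν = η → ν ≠ 0 := by
      rintro ν (rfl | rfl)
      · exact one_ne_zero
      · exact hη0
    have hVne : ∀ {ν}, V ν → ν ≠ 0 := fun hν h => hV0 (h ▸ hν)
    obtain ⟨e1, e2, e3, e4⟩ := h
    have hanti : c * (y - x') = b - a' := by
      refine mul_left_cancel₀ hd ?_
      linear_combination e2 - e3
    have hdet : c ^ 2 * (x * y' - y * x') = a * b' - b * a' := by
      refine mul_left_cancel₀ (pow_ne_zero 2 hd) ?_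
      linear_combination (c * (k * n - l * m)) * y' * e1 +
        ((k * a + l * a') * k + (k * b + l * b') * l) * e4 - (c * (k * n - l * m)) * x' * e2 -
        ((k * a + l * a') * m + (k * b + l * b') * n) * e3
    rcases hM with ⟨-, ⟨rfl, rfl, rfl, rfl⟩ | ⟨hV₁, rfl, rfl, rfl⟩ | ⟨rfl, rfl, rfl, hν₁⟩ |
      ⟨rfl, rfl, rfl, hr₁, hr₁'⟩⟩ | ⟨h, -⟩ | ⟨rfl, rfl, rfl, rfl⟩ | ⟨rfl, rfl, rfl, hV₁⟩ |
      ⟨rfl, rfl, rfl, rfl⟩ <;>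
    rcases hM' with ⟨-, ⟨rfl, rfl, rfl, rfl⟩ | ⟨hV₂, rfl, rfl, rfl⟩ | ⟨rfl, rfl, rfl, hν₂⟩ |
      ⟨rfl, rfl, rfl, hr₂, hr₂'⟩⟩ | ⟨h', -⟩ | ⟨rfl, rfl, rfl, rfl⟩ | ⟨rfl, rfl, rfl, hV₂⟩ |
      ⟨rfl, rfl, rfl, rfl⟩ <;>
    first
    | exact ⟨rfl, rfl, rfl, rfl⟩
    | exact absurd h hp
    | exact absurd h' hp
    | (exfalso; grind)
    | skip
    -- Equal skew parts force `c = 1`, and the zero last entry makes the base change upper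
    -- triangular, so the parameters differ by the scalar and the square `k ^ 2`.
    · have hc1 : c = 1 := mul_right_cancel₀ h2 (by linear_combination hanti)
      have hm : m = 0 := by
        have : m ^ 2 * a = 0 := by linear_combination -e4
        simpa [hVne hV₁] using this
      have hk : k ≠ 0 := by
        rintro rfl
        simp [hm] at hd
      exact ⟨hV _ _ k hV₁ hV₂ hk (by linear_combination e1), rfl, rfl, rfl⟩
    · exact ⟨rfl, rfl, rfl, eq_of_mul_sq_eq hη hν₁ hν₂ hc one_ne_zero (by linear_combination hdet)⟩
    · have hc1 : c = 1 := mul_right_cancel₀ h2 (by linear_combination hanti)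
      subst hc1
      exact ⟨rfl, rfl, rfl, by linear_combination -hdet⟩
    · have hl : l = 0 := by
        have : l ^ 2 * b' = 0 := by linear_combination -e1
        simpa [hVne hV₁] using this
      have hn : n ≠ 0 := by
        rintro rfl
        simp [hl] at hd
      exact ⟨rfl, rfl, rfl, hV _ _ n hV₁ hV₂ hn (by linear_combination e4)⟩

theorem natCast_ne_of_le {r : ℕ} (hr : 1 ≤ r) (hr' : r ≤ p - 2) :
    (r : ZMod p) ≠ 0 ∧ (r : ZMod p) ≠ -1 := by
  have h2 : 2 ≤ p := (Fact.out : p.Prime).two_le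
  constructor
  · rw [Ne, ZMod.natCast_eq_zero_iff]
    exact fun h => absurd (Nat.le_of_dvd (by omega) h) (by omega)
  · intro h
    have : ((r + 1 : ℕ) : ZMod p) = 0 := by
      rw [Nat.cast_add, h]
      simp
    rw [ZMod.natCast_eq_zero_iff] at this
    exact absurd (Nat.le_of_dvd (by omega) this) (by omega)

/-- Sorts the list by its first row, reducing the comparison of all pairs to three uniform families.
-/
theorem InList.shape {η : ZMod p} {w : Matrix (Fin 3) (Fin 3) (ZMod p)} (h : InList p η w) :
    (∃ a b a' b', w = !![1, 0, 0; 0, a, b; 0, a', b'] ∧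
      IsListBlock η (fun ν => ν = 1 ∨ p ≠ 2 ∧ ν = η) a b a' b') ∨
    (∃ γ₁ γ₂ a b a' b', w = !![0, 0, 0; γ₁, a, b; γ₂, a', b'] ∧
      IsListBlock η (fun ν => ν = 1) a b a' b' ∧
      (γ₁ = 0 ∧ γ₂ = 0 ∨ a = 0 ∧ b = 1 ∧ a' = 0 ∧ b' = 0 ∧ γ₁ = 0 ∧ γ₂ = 1 ∨
        a = 0 ∧ b = 0 ∧ a' = 0 ∧ (b' = 0 ∨ b' = 1) ∧ γ₁ = 1 ∧ γ₂ = 0)) ∨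
    (∃ g₁ g₂ m₁ m₂, w = !![0, 0, 1; g₁, m₁, 0; g₂, m₂, 0] ∧
      (m₁ = 1 ∧ m₂ = 0 ∧ g₁ = 0 ∨ m₁ = 0 ∧ m₂ = 1 ∧ (g₁ = 0 ∨ g₁ = 1) ∧ g₂ = 0 ∨
        m₁ = 0 ∧ m₂ = 0 ∧ g₁ = 1 ∧ g₂ = 0 ∨ m₁ = 0 ∧ m₂ = 0 ∧ g₁ = 0)) := by
  unfold IsListBlock
  cases h with
  | D2 hp ν hν =>
    exact .inl ⟨_, _, _, _, rfl, .inl ⟨hp, .inr (.inl ⟨hν.imp_right (⟨hp, ·⟩), rfl, rfl, rfl⟩)⟩⟩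
  | D4 hp r hr hr' =>
    exact .inl ⟨_, _, _, _, rfl,
      .inl ⟨hp, .inr (.inr (.inr ⟨rfl, rfl, rfl, natCast_ne_of_le hr hr'⟩))⟩⟩
  | E4 hp r hr hr' =>
    exact .inr (.inl ⟨_, _, _, _, _, _, rfl,
      .inl ⟨hp, .inr (.inr (.inr ⟨rfl, rfl, rfl, natCast_ne_of_le hr hr'⟩))⟩, .inl ⟨rfl, rfl⟩⟩)
  | D1 | D3 | D5 | D6 | D7 | E8 | E9 | F1 => exact .inl ⟨_, _, _, _, rfl, by simp_all⟩
  | E1 | E2 | E3 | E5 | E6 | E7 | E10 | E11 | F2 | F3 | F4 | F5 =>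
    exact .inr (.inl ⟨_, _, _, _, _, _, rfl, by simp_all⟩)
  | D8 | D9 | E12 | E13 | E14 | E15 | F6 => exact .inr (.inr ⟨_, _, _, _, rfl, by simp⟩)

theorem InList.eq_of_similar {η : ZMod p} (hη : p ≠ 2 → ¬ IsSquare η)
    {w w' : Matrix (Fin 3) (Fin 3) (ZMod p)} (hw : InList p η w) (hw' : InList p η w')
    (h : Similar w w') : w = w' := by
  have hrow := h.row_eq_zero_iff
  rcases hw.shape with ⟨a, b, a', b', rfl, hM⟩ | ⟨γ₁, γ₂, a, b, a', b', rfl, hM, hγ⟩ |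
    ⟨g₁, g₂, m₁, m₂, rfl, hg⟩ <;>
  rcases hw'.shape with ⟨x, y, x', y', rfl, hM'⟩ | ⟨γ₁', γ₂', x, y, x', y', rfl, hM', hγ'⟩ |
    ⟨g₁', g₂', m₁', m₂', rfl, hg'⟩
  · obtain ⟨k, l, m, n, hd, hc⟩ := h.exists_of_unit_corner
    obtain ⟨rfl, rfl, rfl, rfl⟩ := eq_of_congruent hη hd hd (by
        rintro (h | ⟨hp, h⟩)
        · exact zero_ne_one h
        · exact hη hp (h ▸ IsSquare.zero)) (by
        intro ν ν' t hν hν' ht h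
        by_cases hp : p = 2
        · have e1 : ν = 1 := hν.resolve_right fun h => h.1 hp
          have e2 : ν' = 1 := hν'.resolve_right fun h => h.1 hp
          rw [e1, e2]
        · exact eq_of_mul_sq_eq (hη hp) (hν.imp_right And.right) (hν'.imp_right And.right) hd ht
            (by linear_combination h)) hM hM' hc
    rfl
  · exact absurd h not_similar_unit_corner_zero_row
  · simp at hrow
  · exact absurd h not_similar_zero_row_unit_corner
  · obtain ⟨c, e₁, e₂, k, l, m, n, hc, hd, hcong, h1, h2⟩ := h.exists_of_zero_row
    obtain ⟨rfl, rfl, rfl, rfl⟩ := eq_of_congruent hη hc hd (fun h => zero_ne_one h)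
      (fun _ _ _ h h' _ _ => h.trans h'.symm) hM hM' hcong
    obtain ⟨c1, c2, c3, c4⟩ := hcong
    -- The blocks now agree; nonzero left columns occur only beside singular blocks, outside their
    -- column space.
    obtain ⟨rfl, rfl⟩ : γ₁ = γ₁' ∧ γ₂ = γ₂' := by
      clear hM hM' hrow h hw hw' hη
      rcases hγ with ⟨rfl, rfl⟩ | ⟨rfl, rfl, rfl, rfl, rfl, rfl⟩ | ⟨rfl, rfl, rfl, rfl | rfl, rfl, rfl⟩ <;>
      rcases hγ' with ⟨rfl, rfl⟩ | ⟨h3, h4, h5, h6, rfl, rfl⟩ | ⟨h3, h4, h5, h6, rfl, rfl⟩ <;>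
      first
      | exact ⟨rfl, rfl⟩
      | grind
    rfl
  · simp at hrow
  · simp at hrow
  · simp at hrow
  · obtain ⟨c, n, b, e, hc, hn, h1, h2, h3, h4⟩ := h.exists_of_unit_row
    obtain ⟨rfl, rfl, rfl, rfl⟩ : g₁ = g₁' ∧ g₂ = g₂' ∧ m₁ = m₁' ∧ m₂ = m₂' := by
      clear hrow h hw hw'
      grind
    rfl

end Prime
end CharMat

/-! ### Existence of a characteristic matrix and conclusion -/

namespace CharMat
open Model Matrix

variable {p : ℕ} [Fact p.Prime] {m : Fin 3 → ℕ}

theorem commutator_model_le : commutator (Model p) ≤ (central p).range := by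
  rw [commutator_def, Subgroup.commutator_le]
  intro k _ l _
  rw [commutatorElement_eq]
  exact ⟨Multiplicative.ofAdd (crossProduct (red p k.u) (red p l.u)), rfl⟩

/-- Every group of the class has a characteristic matrix. -/
theorem InClass.exists_presents_matrix {G : Type*} [Group G] [Finite G] (h : InClass p m G)
    (hm : ∀ i, 1 ≤ m i) : ∃ (w : Matrix (Fin 3) (Fin 3) (ZMod p)) (q : Model p →* G),
      Presents m w q := by
  obtain ⟨e⟩ := h.type_eq
  choose a ha using fun i => QuotientGroup.mk_surjective
    (e.symm (Multiplicative.ofAdd (Pi.single i (1 : ZMod (p ^ m i)))))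
  have hea : ∀ i, e (QuotientGroup.mk' (commutator G) (a i)) =
      Multiplicative.ofAdd (Pi.single i (1 : ZMod (p ^ m i))) := fun i =>
    (e.eq_symm_apply).mp (ha i)
  let q := lift h.commutator_le_center h.pow_eq_one a
  have hq : ∀ i, q (gen p i) = a i := lift_gen _ _ a
  have hs : Function.Surjective q := by
    refine MonoidHom.range_eq_top.mp (h.eq_top (eq_top_iff.mpr fun x _ => ?_))
    choose u hu using fun i => ZMod.intCast_surjective ((e x).toAdd i)
    refine ⟨q ⟨u, 0⟩, ⟨_, rfl⟩, ?_⟩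
    apply e.injective
    have hqu : q ⟨u, 0⟩ = a 0 ^ u 0 * a 1 ^ u 1 * a 2 ^ u 2 := by
      rw [eq_gen_zpow_mul ⟨u, 0⟩]
      simp [hq]
    rw [hqu]
    change e (QuotientGroup.mk' (commutator G) _) = _
    rw [map_mul, map_mul, map_mul, map_mul, map_zpow, map_zpow, map_zpow, map_zpow, map_zpow,
      map_zpow, hea, hea, hea, ← ofAdd_zsmul, ← ofAdd_zsmul, ← ofAdd_zsmul, ← ofAdd_add,
      ← ofAdd_add]
    apply Multiplicative.toAdd.injective
    funext i
    rw [← hu i]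
    fin_cases i <;> simp
  have hpow : ∀ i, a i ^ p ^ m i ∈ commutator G := by
    intro i
    rw [← QuotientGroup.ker_mk' (commutator G), MonoidHom.mem_ker]
    apply e.injective
    rw [map_pow, map_pow, hea, map_one, ← ofAdd_nsmul, ← ofAdd_zero, ← Pi.single_smul]
    simp
  have hc : ∀ i, ∃ s, q (central p s) = a i ^ p ^ m i := by
    intro i
    have hi := hpow i
    -- `G'` is the image of the derived subgroup of the model, which consists of central vectors; a
    -- preimage of the power is the row of the matrix.
    rw [commutator_def, ← Subgroup.map_top_of_surjective q hs, ← Subgroup.map_commutator,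
      ← commutator_def] at hi
    obtain ⟨k, hk, hk'⟩ := hi
    obtain ⟨s, rfl⟩ := commutator_model_le hk
    exact ⟨s, hk'⟩
  choose w hw using hc
  refine ⟨of fun i => (w i).toAdd, q, h.presents hm hs fun k hk => eq_one_of_isRel (fun i => ?_) hk⟩
  rw [hq, ← hw]
  rfl

end CharMat

theorem theorem4p1 (p : ℕ) [Fact p.Prime] (η : ZMod p) (hη : p ≠ 2 → ¬ IsSquare η)
    (m₁ m₂ : ℕ) (hm₂ : 1 ≤ m₂) (hm : m₂ < m₁) (h2 : p = 2 → 1 < m₂) :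
    -- every group of the class has a characteristic matrix in the list
    (∀ (G : Type u) [Group G] [Finite G], CharMat.InClass p ![m₁, m₂, m₂] G →
      ∃ w, CharMat.InList p η w ∧ CharMat.IsCharMatrix p ![m₁, m₂, m₂] G w) ∧
    -- every matrix of the list is a characteristic matrix of a group of the class
    (∀ w, CharMat.InList p η w →
      ∃ (G : Type u) (_ : Group G) (_ : Finite G),
        CharMat.InClass p ![m₁, m₂, m₂] G ∧ CharMat.IsCharMatrix p ![m₁, m₂, m₂] G w) ∧
    -- a matrix of the list determines the group, and different matrices of the list give
    -- non-isomorphic groups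
    (∀ (G : Type u) (H : Type v) [Group G] [Finite G] [Group H] [Finite H],
      CharMat.InClass p ![m₁, m₂, m₂] G → CharMat.InClass p ![m₁, m₂, m₂] H →
      ∀ w w' : Matrix (Fin 3) (Fin 3) (ZMod p),
        CharMat.InList p η w → CharMat.InList p η w' →
        CharMat.IsCharMatrix p ![m₁, m₂, m₂] G w → CharMat.IsCharMatrix p ![m₁, m₂, m₂] H w' →
        (Nonempty (G ≃* H) ↔ w = w')) := by
  have hm1 : ∀ i, 1 ≤ ![m₁, m₂, m₂] i := by
    intro i; fin_cases i <;> simp <;> omega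
  refine ⟨fun G _ _ hG => ?_, fun w _ => ?_, fun G H _ _ _ _ hG hH w w' hw hw' hGw hHw' => ?_⟩
  · obtain ⟨w, q, hq⟩ := hG.exists_presents_matrix hm1
    obtain ⟨w', hw', hs⟩ := CharMat.exists_inList hη w
    obtain ⟨q', hq'⟩ := hs.exists_presents hm₂ hm h2 hG hq
    exact ⟨w', hw', hq'.isCharMatrix⟩
  -- The quotient of the model lives in the lowest universe and is lifted to `Type u`.
  · have hP := (CharMat.presents_mk hm1 w).comp_mulEquiv MulEquiv.ulift.{_, u}.symm
    have hf := hP.finite hm1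
    exact ⟨_, inferInstance, hf, hP.inClass hm1, hP.isCharMatrix⟩
  · obtain ⟨q, hq⟩ := hG.exists_presents hm1 hGw
    obtain ⟨q', hq'⟩ := hH.exists_presents hm1 hHw'
    constructor
    · rintro ⟨e⟩
      exact hw.eq_of_similar hη hw' (hq.similar hm₂ hm h2 (hq'.comp_mulEquiv e.symm))
    · rintro rfl
      exact hq.mulEquiv hq'
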